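/- **Theorem (Diagonalization).** Let $X$ be a scheme and $\varphi\colon E\to F$ a homomorphism of locally free sheaves of finite rank on $X$. For $r\ge 0$ let $\mathscr I_{\varphi,r}$ be the determinantal ideal sheaf generated by the $(r+1)\times(r+1)$ minors of the local matrix representations of $\varphi$, and let $m$ be the smallest integer $\ge 0$ with $\bigwedge^{m+1}\varphi=0$, i.e. $\mathscr I_{\varphi,m}=0$ (we assume it exists, as it always does for noetherian $X$). Put $X_{-1}=X$ and, for $0\le r\le m-1$, let $X_r\to X_{r-1}$ be the blowup of $X_{r-1}$ along $\mathscr I_{\varphi_{r-1},r}$, where $\varphi_r\colon E_r\to F_r$ denotes the pullback of $\varphi$ to $X_r$. Let $b\colon\widetilde X:=X_{m-1}\to X$ be the composite. (a) For every $0\le r\le m-1$, the scheme $X_r$ is covered by open subsets $U$ over which there are decompositions into trivial sheaves $E_r=\bigoplus_{i=0}^{r}G_i\oplus G_{r+1}$ and $F_r=\bigoplus_{i=0}^{r}H_i\oplus H_{r+1}$ with $G_i\cong H_i\cong\mathscr O_U$ for $0\le i\le r$, such that: $\varphi_r(G_i)\subset H_i$ for $0\le i\le r+1$; for $0\le i\le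 r$, $\varphi_r|_{G_i}=p_iI_i$ with $0\ne p_i\in\Gamma(U,\mathscr O_U)$ and $I_i\colon G_i\to H_i$ an isomorphism; $p_i\mid p_{i+1}$ for $0\le i\le r-1$; and $p_r$ divides $\varphi_r|_{G_{r+1}}$. In other words, in suitable bases over $U$ one has $\varphi_r=\operatorname{diag}(p_0,\dots,p_r,B)$ with $p_0\mid p_1\mid\dots\mid p_r\mid B$. (b) The homomorphism $b^*\varphi$ is locally diagonalizable: $\widetilde X$ is covered by open subsets $U$ over which there are decompositions into trivial sheaves $b^*E=G_0\oplus\bigoplus_{i=1}^{l}G_i$ and $b^*F=H_0\oplus\bigoplus_{i=1}^{l}H_i$ such that $b^*\varphi$ vanishes on $G_0$, and for $1\le i\le l$ restricts on $G_i$ to $p_iI_i$ with $0\ne p_i\in\Gamma(U,\mathscr O_U)$ and $I_i\colon G_i\to H_i$ an isomorphism, where $\langle p_1\rangle\supsetneq\langle p_2\rangle\supsetneq\dots\supsetneq\langle p_l\rangle$. (c) For every irreducible component $\widetilde X'$ of $\widetilde X$ with its reduced scheme structure, the kernel sheaf $\ker(b^*\varphi|_{\widetilde X'})$ of the restricted homomorphism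 is locally free of finite rank. -/

import Mathlib

open CategoryTheory AlgebraicGeometry

universe u

namespace DetBlowup

/-- The sections `e i` of `M` over `U` form a frame, i.e. they induce an isomorphism of sheaves
from the trivial sheaf (the direct sum of copies of the structure sheaf of `U` indexed by `ι`)
onto the restriction of `M` to `U`: over every open `V ≤ U`, each section of `M` is a unique
linear combination of the restrictions of the `e i`. -/
def IsFrame {X : Scheme.{u}} (M : X.Modules) (U : X.Opens) {ι : Type} [Fintype ι]
    (e : ι → Γ(M, U)) : Prop :=
  ∀ (V : X.Opens) (h : V ≤ U), Function.Bijective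
    (fun c : ι → Γ(X, V) => ∑ i, c i • (M.presheaf.map (homOfLE h).op (e i) : Γ(M, V)))

/-- Locally free sheaves of modules, of finite (not necessarily constant) rank. -/
def IsLocallyFree {X : Scheme.{u}} (M : X.Modules) : Prop :=
  ∀ x : X, ∃ U : X.Opens, x ∈ U ∧ ∃ (n : ℕ) (e : Fin n → Γ(M, U)), IsFrame M U e

/-- `A` is the matrix of `φ` over `U` in the frames `e` of the source and `f` of the target:
`φ (e j) = ∑ i, A i j • f i`. -/
def IsMatrixOf {X : Scheme.{u}} {E F : X.Modules} (φ : E ⟶ F) (U : X.Opens)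
    {ι κ : Type} [Fintype ι] [Fintype κ] (e : ι → Γ(E, U)) (f : κ → Γ(F, U))
    (A : Matrix κ ι Γ(X, U)) : Prop :=
  IsFrame E U e ∧ IsFrame F U f ∧ ∀ j, φ.app U (e j) = ∑ i, A i j • f i

/-- The determinantal ideal sheaf of index `r` of a map `φ` of locally free sheaves: the ideal
sheaf generated by the `(r + 1) × (r + 1)` minors of all local matrix representations of `φ`,
that is, the smallest quasi-coherent ideal sheaf containing these minors. (Rows and columns are
selected by arbitrary maps; this only adds zero and signs to the list of minors.) -/
noncomputable def detIdeal {X : Scheme.{u}} {E F : X.Modules} (φ : E ⟶ F) (r : ℕ) :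
    X.IdealSheafData :=
  sInf {J | ∀ (U : X.affineOpens) (a b : ℕ) (e : Fin a → Γ(E, U.1)) (f : Fin b → Γ(F, U.1))
    (A : Matrix (Fin b) (Fin a) Γ(X, U.1)), IsMatrixOf φ U.1 e f A →
    ∀ (s : Fin (r + 1) → Fin b) (t : Fin (r + 1) → Fin a),
      (A.submatrix s t).det ∈ J.ideal U}

/-- An invertible ideal sheaf: locally generated by one nonzerodivisor. -/
def IsInvertible {X : Scheme.{u}} (I : X.IdealSheafData) : Prop :=
  ∀ x : X, ∃ U : X.affineOpens, x ∈ U.1 ∧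
    ∃ p ∈ nonZeroDivisors Γ(X, U.1), I.ideal U = Ideal.span {p}

/-- `b : Y ⟶ X` is the blowup of `X` along the ideal sheaf `I`: the inverse image ideal sheaf of
`I` on `Y` is invertible, and `b` is universal (terminal) among the morphisms to `X` with this
property. This determines `b` up to unique isomorphism. -/
structure IsBlowup {X Y : Scheme.{u}} (b : Y ⟶ X) (I : X.IdealSheafData) : Prop where
  invertible : IsInvertible (I.comap b)
  existsUnique_lift : ∀ (Z : Scheme.{u}) (f : Z ⟶ X), IsInvertible (I.comap f) →
    ∃! g : Z ⟶ Y, g ≫ b = f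

/-- The pullback of a map of sheaves of modules along a morphism of schemes. -/
noncomputable abbrev pullbackMap {X Y : Scheme.{u}} (g : Y ⟶ X) {E F : X.Modules} (φ : E ⟶ F) :
    (Scheme.Modules.pullback g).obj E ⟶ (Scheme.Modules.pullback g).obj F :=
  (Scheme.Modules.pullback g).map φ

/-- `g : Y ⟶ X` is the composition of the first `n` successive determinantal blowups of `φ`:
starting from `X`, the `k`-th step (`k = 0, …, n - 1`) blows up the determinantal ideal of index
`k` of the pullback of `φ` to the scheme obtained so far. The scheme usually called `X_r` is thus
the one with `n = r + 1`, and `n = 0` is `X` itself. -/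
inductive IsIteratedBlowup {X : Scheme.{u}} {E F : X.Modules} (φ : E ⟶ F) :
    (n : ℕ) → {Y : Scheme.{u}} → (Y ⟶ X) → Prop
  | zero : IsIteratedBlowup φ 0 (𝟙 X)
  | succ {n : ℕ} {Y Y' : Scheme.{u}} (g : Y ⟶ X) (b : Y' ⟶ Y) :
      IsIteratedBlowup φ n g → IsBlowup b (detIdeal (pullbackMap g φ) n) →
      IsIteratedBlowup φ (n + 1) (b ≫ g)

/-- `φ` is diagonalizable over `U`: there are decompositions into trivial sheaves
`E|_U = G_0 ⊕ G_1 ⊕ ⋯ ⊕ G_l` and `F|_U = H_0 ⊕ H_1 ⊕ ⋯ ⊕ H_l` such that `φ` vanishes on `G_0` and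
is `p_i` times an isomorphism `G_i ≅ H_i` for `i ≥ 1`, where the `p_i` are nonzero and generate a
strictly decreasing chain of ideals. The summands are spanned by the parts of two frames, `d i`
being the rank of `G_i` and `H_i` for `i ≥ 1`. -/
def IsDiagonalizableOver {X : Scheme.{u}} {E F : X.Modules} (φ : E ⟶ F) (U : X.Opens) : Prop :=
  ∃ (l a b : ℕ) (d : Fin l → ℕ) (e : Fin a ⊕ (Σ i, Fin (d i)) → Γ(E, U))
    (f : Fin b ⊕ (Σ i, Fin (d i)) → Γ(F, U)) (p : Fin l → Γ(X, U)),
    IsFrame E U e ∧ IsFrame F U f ∧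
    (∀ j, φ.app U (e (Sum.inl j)) = 0) ∧
    (∀ (i : Fin l) (j : Fin (d i)),
      φ.app U (e (Sum.inr ⟨i, j⟩)) = p i • f (Sum.inr ⟨i, j⟩)) ∧
    (∀ i, p i ≠ 0) ∧
    (∀ i j, i < j → Ideal.span {p j} < Ideal.span {p i})

/-- `φ` is diagonalizable over the members of an open covering. -/
def IsLocallyDiagonalizable {X : Scheme.{u}} {E F : X.Modules} (φ : E ⟶ F) : Prop :=
  ∀ x : X, ∃ U : X.Opens, x ∈ U ∧ IsDiagonalizableOver φ U

/-- Over `U`, the map `φ` is `diag(p_0, …, p_r, B)` in suitable frames, with all `p_i ≠ 0`, with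
`p_i ∣ p_{i+1}`, and with `p_r` dividing `B`. -/
def HasDiagonalFormOver {X : Scheme.{u}} {E F : X.Modules} (φ : E ⟶ F) (r : ℕ)
    (U : X.Opens) : Prop :=
  ∃ (a b : ℕ) (e : Fin (r + 1) ⊕ Fin a → Γ(E, U)) (f : Fin (r + 1) ⊕ Fin b → Γ(F, U))
    (p : Fin (r + 1) → Γ(X, U)) (B : Matrix (Fin b) (Fin a) Γ(X, U)),
    IsMatrixOf φ U e f (Matrix.fromBlocks (Matrix.diagonal p) 0 0 B) ∧
    (∀ i, p i ≠ 0) ∧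
    (∀ i : Fin r, p i.castSucc ∣ p i.succ) ∧
    (∀ k j, p (Fin.last r) ∣ B k j)

end DetBlowup

/-! The engine is a pivoting induction. Suppose that after `n` blowups the map is locally `diag(p_1,
…, p_n, B)`, with nonzerodivisors `p_i`, each dividing the later ones and `B`. Every term of an
`(n+1)`-minor uses some row of `B`, and the other factors absorb `∏ p_i`. So the minors generate `(∏
p_i) · (entries of B)` (`minorIdeal_diagBlock_le`, `prod_mul_mem_minorIdeal`).

Blowing up makes the pullback of this ideal locally principal, with a nonzerodivisor generator `q`.
Then `q = (∏ p_i) · s`, where `s` is again a nonzerodivisor, and cancelling `∏ p_i` gives `B = s ·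
c` where the entries of `c` generate the unit ideal (`exists_entry_factor`). Near each point some
entry of `c` is invertible, so the corresponding entry of `B` divides all of `B`. Clearing its row
and column makes it the next diagonal entry (`exists_pivot`, `hasDiagBlock_pullback`).

After `m` steps the `(m+1)`-minors vanish, so `(∏ p_i) · B = 0` and hence `B = 0`. Grouping
associated `p_i` gives the strict chain of ideals. On an integral closed subscheme a nonzero
diagonal entry stays a nonzerodivisor over every smaller nonempty open, so the kernel is free on the
frame vectors whose diagonal entry is zero.

Two foundational facts support this. Frames pull back to frames (`IsFrame.pullback`), because a
global frame is characterised by a mapping property that left adjoints preserve. The determinantal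
ideal, defined as an infimum, is computed over any affine open by the minors of any one matrix
(`IsMatrixOf.detIdeal_eq`). -/

namespace DetBlowup

/-! ### Restriction of sections and frames -/

section Sections

variable {X : Scheme.{u}}

/-- Restriction of functions to a smaller open subset. -/
noncomputable def resO {V U : X.Opens} (h : V ≤ U) : Γ(X, U) →+* Γ(X, V) :=
  (X.presheaf.map (homOfLE h).op).hom

/-- Restriction of sections of a sheaf of modules to a smaller open subset. -/
noncomputable def resM (M : X.Modules) {V U : X.Opens} (h : V ≤ U) : Γ(M, U) →+ Γ(M, V) :=
  (M.presheaf.map (homOfLE h).op).hom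

/-- A morphism of sheaves of modules, as an additive map on sections over `U`. -/
noncomputable def appM {M N : X.Modules} (φ : M ⟶ N) (U : X.Opens) :
    Γ(M, U) →ₗ[Γ(X, U)] Γ(N, U) where
  toFun := φ.app U
  map_add' := map_add _
  map_smul' _ _ := φ.app_smul _ _

lemma resO_resO {W V U : X.Opens} (h : V ≤ U) (h' : W ≤ V) (x : Γ(X, U)) :
    resO h' (resO h x) = resO (h'.trans h) x := by
  simp only [resO, ← CommRingCat.comp_apply, ← Functor.map_comp]
  rfl

lemma resM_resM {M : X.Modules} {W V U : X.Opens} (h : V ≤ U) (h' : W ≤ V) (x : Γ(M, U)) :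
    resM M h' (resM M h x) = resM M (h'.trans h) x := by
  have : M.presheaf.map (homOfLE h).op ≫ M.presheaf.map (homOfLE h').op =
    M.presheaf.map (homOfLE (h'.trans h)).op := by rw [← Functor.map_comp]; rfl
  exact congr($this x)

@[simp]
lemma resO_self {U : X.Opens} (x : Γ(X, U)) : resO le_rfl x = x := by
  have : X.presheaf.map (homOfLE (le_refl U)).op = 𝟙 _ := X.presheaf.map_id _
  exact congr($this x)

@[simp]
lemma resM_self {M : X.Modules} {U : X.Opens} (x : Γ(M, U)) : resM M le_rfl x = x := by
  have : M.presheaf.map (homOfLE (le_refl U)).op = 𝟙 _ := M.presheaf.map_id _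
  exact congr($this x)

lemma resM_smul {M : X.Modules} {V U : X.Opens} (h : V ≤ U) (r : Γ(X, U)) (x : Γ(M, U)) :
    resM M h (r • x) = resO h r • resM M h x :=
  M.map_smul _ _ _

lemma appM_resM {M N : X.Modules} (φ : M ⟶ N) {V U : X.Opens} (h : V ≤ U) (x : Γ(M, U)) :
    appM φ V (resM M h x) = resM N h (appM φ U x) := by
  have := φ.mapPresheaf.naturality (homOfLE h).op
  exact congr($this x)

lemma isFrame_iff {M : X.Modules} {U : X.Opens} {ι : Type} [Fintype ι] {e : ι → Γ(M, U)} :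
    IsFrame M U e ↔ ∀ (V : X.Opens) (h : V ≤ U), Function.Bijective
      (fun c : ι → Γ(X, V) => ∑ i, c i • resM M h (e i)) := Iff.rfl

lemma IsFrame.res {M : X.Modules} {V U : X.Opens} {ι : Type} [Fintype ι] {e : ι → Γ(M, U)}
    (he : IsFrame M U e) (h : V ≤ U) : IsFrame M V (fun i => resM M h (e i)) := by
  rw [isFrame_iff] at he ⊢
  intro W hW
  simpa only [resM_resM] using he W (hW.trans h)

lemma IsFrame.map_iso {M N : X.Modules} {U : X.Opens} {ι : Type} [Fintype ι] {e : ι → Γ(M, U)}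
    (he : IsFrame M U e) (φ : M ≅ N) : IsFrame N U (fun i => appM φ.hom U (e i)) := by
  rw [isFrame_iff] at he ⊢
  intro V hV
  have hb : Function.Bijective (appM φ.hom V) := by
    refine Function.bijective_iff_has_inverse.mpr ⟨appM φ.inv V, fun x => ?_, fun x => ?_⟩
    · have : φ.hom.app V ≫ φ.inv.app V = 𝟙 _ := by
        rw [← Scheme.Modules.Hom.comp_app, φ.hom_inv_id]; rfl
      exact congr($this x)
    · have : φ.inv.app V ≫ φ.hom.app V = 𝟙 _ := by
        rw [← Scheme.Modules.Hom.comp_app, φ.inv_hom_id]; rfl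
      exact congr($this x)
  convert hb.comp (he V hV) using 2 with c
  simp [map_sum, map_smul, appM_resM]

end Sections

/-! ### Free modules and the mapping property of a global frame -/

section Free

variable (X : Scheme.{u})

/-- The structure sheaf as a module over itself. -/
noncomputable abbrev unitM : X.Modules := SheafOfModules.unit X.ringCatSheaf

variable {X}

/-- A function, as a section of the structure sheaf viewed as a module. -/
def toUnit {U : X.Opens} (f : Γ(X, U)) : Γ(unitM X, U) := f

/-- A section of the structure sheaf viewed as a module, as a function. -/
def ofUnit {U : X.Opens} (f : Γ(unitM X, U)) : Γ(X, U) := f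

lemma smul_toUnit_one {U : X.Opens} (f : Γ(unitM X, U)) : ofUnit f • toUnit (1 : Γ(X, U)) = f :=
  mul_one (ofUnit f)

lemma resM_toUnit {V U : X.Opens} (h : V ≤ U) (f : Γ(X, U)) :
  resM (unitM X) h (toUnit f) = toUnit (resO h f) := rfl

/-- The multiples of a section, as a map on the structure sheaf. -/
noncomputable def unitToSpan {M : X.Modules} {U : X.Opens} (m : Γ(M, U)) :
    Γ(unitM X, U) →+ Γ(M, U) where
  toFun f := ofUnit f • m
  map_zero' := zero_smul Γ(X, U) m
  map_add' a b := add_smul (ofUnit a) (ofUnit b) m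

lemma unitToSpan_smul {M : X.Modules} {U : X.Opens} (m : Γ(M, U)) (r : Γ(X, U))
    (x : Γ(unitM X, U)) : unitToSpan m (r • x) = r • unitToSpan m x :=
  mul_smul r (ofUnit x) m

lemma resM_unitToSpan {M : X.Modules} {V U : X.Opens} (h : V ≤ U) (m : Γ(M, U))
    (x : Γ(unitM X, U)) :
    unitToSpan (resM M h m) (resM (unitM X) h x) = resM M h (unitToSpan m x) :=
  (resM_smul h (ofUnit x) m).symm

/-- The morphism from the structure sheaf given by a global section. -/
noncomputable def homOfSection {M : X.Modules} (m : Γ(M, ⊤)) : unitM X ⟶ M where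
  val := PresheafOfModules.homMk
    { app V := AddCommGrpCat.ofHom (unitToSpan (resM M (le_top (a := V.unop)) m))
      naturality := by
        intro V W f
        ext x
        have := resM_unitToSpan (leOfHom f.unop) (resM M le_top m) x
        rw [resM_resM] at this
        exact this }
    (fun V r x => unitToSpan_smul (U := V.unop) _ _ _)

lemma homOfSection_one {M : X.Modules} (m : Γ(M, ⊤)) :
    appM (homOfSection m) ⊤ (toUnit 1) = m := by
  change (1 : Γ(X, ⊤)) • resM M le_rfl m = m
  rw [one_smul, resM_self]

lemma unit_hom_ext {M : X.Modules} {φ ψ : unitM X ⟶ M}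
    (h : appM φ ⊤ (toUnit 1) = appM ψ ⊤ (toUnit 1)) : φ = ψ := by
  ext U x
  change appM φ U x = appM ψ U x
  rw [← smul_toUnit_one x, map_smul, map_smul, ← map_one (resO (le_top (a := U))), ← resM_toUnit,
    appM_resM, appM_resM, h]

instance : Limits.HasFiniteBiproducts X.Modules := Abelian.hasFiniteBiproducts

/-- The free module on a finite type. -/
noncomputable def freeM (X : Scheme.{u}) (ι : Type) [Fintype ι] : X.Modules :=
  ⨁ fun _ : ι => unitM X

variable {ι : Type} [Fintype ι]

/-- The inclusion of a summand of the free module. -/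
noncomputable def freeι (i : ι) : unitM X ⟶ freeM X ι :=
  Limits.biproduct.ι (fun _ : ι => unitM X) i

/-- The projection of the free module to a summand. -/
noncomputable def freeπ (i : ι) : freeM X ι ⟶ unitM X :=
  Limits.biproduct.π (fun _ : ι => unitM X) i

lemma freeι_freeπ_self (i : ι) : freeι (X := X) i ≫ freeπ i = 𝟙 _ :=
  Limits.biproduct.ι_π_self _ _

lemma freeι_freeπ_ne {i j : ι} (h : i ≠ j) : freeι (X := X) i ≫ freeπ j = 0 :=
  Limits.biproduct.ι_π_ne _ h

lemma free_total : ∑ i : ι, freeπ (X := X) i ≫ freeι i = 𝟙 (freeM X ι) :=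
  Limits.biproduct.total

/-- The standard basis of the free module. -/
noncomputable def freeE (i : ι) : Γ(freeM X ι, ⊤) :=
  appM (freeι i) ⊤ (toUnit 1)

lemma appM_comp {M N K : X.Modules} (φ : M ⟶ N) (ψ : N ⟶ K) (U : X.Opens) (x : Γ(M, U)) :
    appM (φ ≫ ψ) U x = appM ψ U (appM φ U x) := rfl

lemma appM_zero {M N : X.Modules} (U : X.Opens) (x : Γ(M, U)) :
    appM (0 : M ⟶ N) U x = 0 := rfl

lemma appM_id {M : X.Modules} (U : X.Opens) (x : Γ(M, U)) : appM (𝟙 M) U x = x := rfl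

lemma appM_sum {M N : X.Modules} (φ : ι → (M ⟶ N)) (U : X.Opens) (x : Γ(M, U)) :
    appM (∑ i, φ i) U x = ∑ i, appM (φ i) U x := by
  let ev : (M ⟶ N) →+ Γ(N, U) :=
    { toFun := fun φ => appM φ U x, map_zero' := rfl, map_add' := fun _ _ => rfl }
  exact map_sum ev _ _

lemma resM_freeE {V : X.Opens} (i : ι) :
    resM (freeM X ι) (le_top (a := V)) (freeE i) = appM (freeι i) V (toUnit 1) := by
  rw [freeE, ← appM_resM, resM_toUnit, map_one]

lemma appM_freeπ_freeι (i j : ι) [Decidable (j = i)] (U : X.Opens) (x : Γ(unitM X, U)) :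
    appM (freeπ i) U (appM (freeι j) U x) = if j = i then x else 0 := by
  rw [← appM_comp]
  split_ifs with h
  · subst h
    rw [freeι_freeπ_self, appM_id]
  · rw [freeι_freeπ_ne h, appM_zero]

lemma isFrame_freeE : IsFrame (freeM X ι) ⊤ (freeE (X := X) (ι := ι)) := by
  classical
  rw [isFrame_iff]
  intro V hV
  simp only [resM_freeE]
  refine Function.bijective_iff_has_inverse.mpr
    ⟨fun s i => ofUnit (appM (freeπ i) V s), fun c => ?_, fun s => ?_⟩
  · funext i
    have h (j : ι) : appM (freeπ i) V (c j • appM (freeι j) V (toUnit 1)) =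
        if j = i then c j • toUnit 1 else 0 := by
      rw [← map_smul, appM_freeπ_freeι]
    beta_reduce
    rw [map_sum, Finset.sum_congr rfl fun j _ => h j, Finset.sum_ite_eq' Finset.univ i,
      if_pos (Finset.mem_univ i)]
    exact mul_one _
  · have h (i : ι) : ofUnit (appM (freeπ i) V s) • appM (freeι (X := X) i) V (toUnit 1) =
        appM (freeπ i ≫ freeι i) V s := by
      rw [← map_smul, smul_toUnit_one, appM_comp]
    simp only [h]
    rw [← appM_sum, free_total, appM_id]

lemma freeM_hom_bijective (N : X.Modules) :
    Function.Bijective (fun (ψ : freeM X ι ⟶ N) (i : ι) => appM ψ ⊤ (freeE i)) := by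
  constructor
  · intro φ ψ h
    refine Limits.biproduct.hom_ext' _ _ fun i => ?_
    exact unit_hom_ext (congrFun h i)
  · intro n
    refine ⟨Limits.biproduct.desc fun i => homOfSection (n i), ?_⟩
    funext i
    have : freeι i ≫ Limits.biproduct.desc (fun i => homOfSection (n i)) = homOfSection (n i) :=
      Limits.biproduct.ι_desc _ _
    change appM (freeι i ≫ _) ⊤ (toUnit 1) = n i
    rw [this]
    exact homOfSection_one _

/-- A global frame induces an isomorphism from a free module. -/
lemma IsFrame.exists_iso {M : X.Modules} {e : ι → Γ(M, ⊤)} (he : IsFrame M ⊤ e) :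
    ∃ f : freeM X ι ≅ M, ∀ i, appM f.hom ⊤ (freeE i) = e i := by
  obtain ⟨ψ, hψ⟩ := (freeM_hom_bijective M).2 e
  have hψ' (i : ι) : appM ψ ⊤ (freeE i) = e i := congrFun hψ i
  have : IsIso ψ := by
    rw [Scheme.Modules.Hom.isIso_iff_isIso_app]
    intro V
    have h1 := he V le_top
    have h2 := isFrame_freeE (X := X) (ι := ι) V le_top
    have hb : Function.Bijective (appM ψ V) := by
      rw [← Function.Bijective.of_comp_iff _ h2]
      convert h1 using 2 with c
      simp only [Function.comp, map_sum, map_smul, ← hψ']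
      exact Finset.sum_congr rfl fun i _ => congrArg _ (appM_resM ψ _ _)
    exact (ConcreteCategory.isIso_iff_bijective (ψ.app V)).mpr hb
  exact ⟨asIso ψ, hψ'⟩

/-- A free module with its basis represents `N ↦ Γ(N, ⊤)^ι`. In this form the frame condition no
longer refers to sections over smaller opens, so it passes through an adjunction. -/
lemma isFrame_top_iff {M : X.Modules} {e : ι → Γ(M, ⊤)} :
    IsFrame M ⊤ e ↔ ∀ N : X.Modules,
      Function.Bijective (fun (ψ : M ⟶ N) (i : ι) => appM ψ ⊤ (e i)) := by
  constructor
  · intro he N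
    obtain ⟨f, hf⟩ := he.exists_iso
    have := (freeM_hom_bijective (ι := ι) N).comp (f.homFromEquiv (Z := N)).symm.bijective
    convert this using 2 with ψ
    funext i
    rw [← hf]
    rfl
  · intro h
    obtain ⟨ψ, hψ⟩ := (h (freeM X ι)).2 freeE
    obtain ⟨χ, hχ⟩ := (freeM_hom_bijective M).2 e
    have hψ' (i : ι) : appM ψ ⊤ (e i) = freeE i := congrFun hψ i
    have hχ' (i : ι) : appM χ ⊤ (freeE i) = e i := congrFun hχ i
    let f : freeM X ι ≅ M :=
      { hom := χ
        inv := ψ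
        hom_inv_id := (freeM_hom_bijective _).1 (by
          funext i
          change appM ψ _ (appM χ _ _) = _
          rw [hχ', hψ']; rfl)
        inv_hom_id := (h M).1 (by
          funext i
          change appM χ _ (appM ψ _ _) = _
          rw [hψ', hχ']; rfl) }
    convert isFrame_freeE.map_iso f using 2 with i
    exact (hχ' i).symm

end Free

/-! ### Pullback of sections and frames -/

section Pullback

variable {X Y Z : Scheme.{u}}

/-- The pullback of sections of a sheaf of modules. -/
noncomputable def pullSec (g : Y ⟶ X) {M : X.Modules} {U : X.Opens} (s : Γ(M, U)) :
    Γ((Scheme.Modules.pullback g).obj M, g ⁻¹ᵁ U) :=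
  appM ((Scheme.Modules.pullbackPushforwardAdjunction g).unit.app M) U s

lemma pullSec_smul (g : Y ⟶ X) {M : X.Modules} {U : X.Opens} (r : Γ(X, U)) (s : Γ(M, U)) :
    pullSec g (r • s) = (g.app U).hom r • pullSec g s :=
  map_smul (appM ((Scheme.Modules.pullbackPushforwardAdjunction g).unit.app M) U) r s

lemma pullSec_sum (g : Y ⟶ X) {M : X.Modules} {U : X.Opens} {ι : Type} [Fintype ι]
    (s : ι → Γ(M, U)) : pullSec g (∑ i, s i) = ∑ i, pullSec g (s i) :=
  map_sum (appM ((Scheme.Modules.pullbackPushforwardAdjunction g).unit.app M) U) s Finset.univ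

lemma pullSec_appM (g : Y ⟶ X) {M N : X.Modules} (φ : M ⟶ N) {U : X.Opens} (s : Γ(M, U)) :
    appM (pullbackMap g φ) (g ⁻¹ᵁ U) (pullSec g s) = pullSec g (appM φ U s) := by
  have := (Scheme.Modules.pullbackPushforwardAdjunction g).unit.naturality φ
  exact congr(appM $this U s).symm

/-- The pullback along a composition. -/
noncomputable def pullCompIso (h : Z ⟶ Y) (g : Y ⟶ X) (M : X.Modules) :
    (Scheme.Modules.pullback h).obj ((Scheme.Modules.pullback g).obj M) ≅
      (Scheme.Modules.pullback (h ≫ g)).obj M :=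
  (Scheme.Modules.pullbackComp h g).app M

lemma pullCompIso_naturality (h : Z ⟶ Y) (g : Y ⟶ X) {M N : X.Modules} (φ : M ⟶ N) :
    pullbackMap h (pullbackMap g φ) ≫ (pullCompIso h g N).hom =
      (pullCompIso h g M).hom ≫ pullbackMap (h ≫ g) φ :=
  (Scheme.Modules.pullbackComp h g).hom.naturality φ

lemma appM_hom_inv {M N : X.Modules} (f : M ≅ N) (U : X.Opens) (x : Γ(N, U)) :
    appM f.hom U (appM f.inv U x) = x := by
  rw [← appM_comp, f.inv_hom_id, appM_id]

lemma appM_inv_hom {M N : X.Modules} (f : M ≅ N) (U : X.Opens) (x : Γ(M, U)) :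
    appM f.inv U (appM f.hom U x) = x := by
  rw [← appM_comp, f.hom_inv_id, appM_id]

/-- Pulling back a section is the unit of the adjunction, and `pullbackComp` is conjugate to the
comparison of the pushforwards, so it matches the two units. -/
lemma pullSec_comp (h : Z ⟶ Y) (g : Y ⟶ X) {M : X.Modules} {U : X.Opens} (s : Γ(M, U)) :
    appM (pullCompIso h g M).hom (h ⁻¹ᵁ g ⁻¹ᵁ U)
      (pullSec h (pullSec g s)) = pullSec (h ≫ g) s := by
  have h1 := unit_conjugateEquiv ((Scheme.Modules.pullbackPushforwardAdjunction g).comp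
    (Scheme.Modules.pullbackPushforwardAdjunction h))
      (Scheme.Modules.pullbackPushforwardAdjunction (h ≫ g))
      (Scheme.Modules.pullbackComp h g).inv M
  rw [Scheme.Modules.conjugateEquiv_pullbackComp_inv] at h1
  have h2 : pullSec h (pullSec g s) = appM (pullCompIso h g M).inv
      (h ⁻¹ᵁ g ⁻¹ᵁ U) (pullSec (h ≫ g) s) := congr(appM $h1 U s)
  rw [h2]
  exact appM_hom_inv _ _ _

/-- `Hom(g^* M, N) = Hom(M, g_* N) = Γ(g_* N, ⊤)^ι = Γ(N, ⊤)^ι`, and the composite is evaluation at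
the pulled back sections. -/
lemma pullback_isFrame_top (g : Y ⟶ X) {M : X.Modules} {ι : Type} [Fintype ι]
    {e : ι → Γ(M, ⊤)} (he : IsFrame M ⊤ e) :
    IsFrame ((Scheme.Modules.pullback g).obj M) (g ⁻¹ᵁ ⊤) (fun i => pullSec g (e i)) := by
  refine isFrame_top_iff.mpr fun N => ?_
  have h := (isFrame_top_iff.mp he) ((Scheme.Modules.pushforward g).obj N)
  have := h.comp ((Scheme.Modules.pullbackPushforwardAdjunction g).homEquiv M N).bijective
  have h2 : (fun (ψ : (Scheme.Modules.pullback g).obj M ⟶ N) (i : ι) =>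
      appM ψ ⊤ (pullSec g (e i))) = (fun ψ i => (appM ψ ⊤) (e i)) ∘
      ⇑((Scheme.Modules.pullbackPushforwardAdjunction g).homEquiv M N) := by
    funext ψ i
    simp only [Function.comp, Adjunction.homEquiv_unit]
    rfl
  exact h2 ▸ this

/-- The restriction of sections to an open subscheme. -/
noncomputable def restrSec (j : Z ⟶ X) [IsOpenImmersion j] {M : X.Modules} {U : X.Opens}
    (s : Γ(M, U)) : Γ(M.restrict j, j ⁻¹ᵁ U) :=
  appM ((Scheme.Modules.restrictAdjunction j).unit.app M) U s

/-- Sections of the restriction over `V'` are sections of `M` over `j ''ᵁ V'`; only the scalars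
change, by the isomorphism `j.appIso`. The condition `hU` makes every `V ≤ U` such an image. -/
lemma isFrame_restrict_iff (j : Z ⟶ X) [IsOpenImmersion j] {M : X.Modules} {U : X.Opens}
    (hU : U ≤ j.opensRange) {ι : Type} [Fintype ι] {e : ι → Γ(M, U)} :
    IsFrame (M.restrict j) (j ⁻¹ᵁ U)
      (fun i => restrSec j (e i)) ↔
    IsFrame M U e := by
  have key (V' : Z.Opens) (hV' : V' ≤ j ⁻¹ᵁ U) (hV : j ''ᵁ V' ≤ U) :
      Function.Bijective (fun c : ι → Γ(Z, V') => ∑ i, c i • resM (M.restrict j) hV'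
        (restrSec j (e i))) ↔
      Function.Bijective (fun c : ι → Γ(X, j ''ᵁ V') => ∑ i, c i • resM M hV (e i)) := by
    have hinv : Function.Bijective (fun (c : ι → Γ(Z, V')) i => (j.appIso V').inv (c i)) :=
      (Equiv.piCongrRight fun _ : ι =>
        (j.appIso V').symm.commRingCatIsoToRingEquiv.toEquiv).bijective
    have : (fun c : ι → Γ(Z, V') => ∑ i, c i • resM (M.restrict j) hV'
        (restrSec j (e i))) =
      (fun c : ι → Γ(X, j ''ᵁ V') => ∑ i, c i • resM M hV (e i)) ∘
        (fun (c : ι → Γ(Z, V')) i => (j.appIso V').inv (c i)) := by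
      funext c
      refine Finset.sum_congr rfl fun i _ => ?_
      have h1 : resM (M.restrict j) hV'
        (restrSec j (e i)) =
        resM M (j.image_mono hV') (resM M (j.image_preimage_le U) (e i)) := rfl
      rw [h1, resM_resM]
      rfl
    rw [this]
    exact Function.Bijective.of_comp_iff _ hinv
  rw [isFrame_iff, isFrame_iff]
  constructor
  · intro h V hV
    have hV2 : j ''ᵁ (j ⁻¹ᵁ V) = V := by
      rw [Scheme.Hom.image_preimage_eq_opensRange_inf, inf_eq_right]
      exact hV.trans hU
    have hle : j ''ᵁ (j ⁻¹ᵁ V) ≤ U := hV2.trans_le hV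
    have := (key (j ⁻¹ᵁ V) (j.preimage_mono hV) hle).mp (h _ _)
    revert this hle
    rw [hV2]
    exact fun _ h => h
  · intro h V' hV'
    have hle : j ''ᵁ V' ≤ U := (j.image_mono hV').trans (j.image_preimage_le U)
    exact (key V' hV' hle).mpr (h _ _)

lemma isFrame_iso_iff {M N : X.Modules} {U : X.Opens} {ι : Type} [Fintype ι] {e : ι → Γ(M, U)}
    (φ : M ≅ N) : IsFrame N U (fun i => appM φ.hom U (e i)) ↔ IsFrame M U e := by
  refine ⟨fun h => ?_, fun h => h.map_iso φ⟩
  convert h.map_iso φ.symm using 2 with i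
  exact (appM_inv_hom _ _ _).symm

lemma isFrame_pullSec_of_isOpenImmersion_iff (j : Z ⟶ X) [IsOpenImmersion j] {M : X.Modules}
    {U : X.Opens} (hU : U ≤ j.opensRange) {ι : Type} [Fintype ι] {e : ι → Γ(M, U)} :
    IsFrame ((Scheme.Modules.pullback j).obj M) (j ⁻¹ᵁ U) (fun i => pullSec j (e i)) ↔
    IsFrame M U e := by
  rw [← isFrame_restrict_iff j hU]
  let f : M.restrict j ≅ (Scheme.Modules.pullback j).obj M :=
    (Scheme.Modules.restrictFunctorIsoPullback j).app M
  have h1 := Adjunction.unit_leftAdjointUniq_hom_app (Scheme.Modules.restrictAdjunction j)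
    (Scheme.Modules.pullbackPushforwardAdjunction j) M
  have h2 (i : ι) : pullSec j (e i) = appM f.hom (j ⁻¹ᵁ U) (restrSec j (e i)) :=
    congr(appM $h1 U (e i)).symm
  simp only [h2]
  exact isFrame_iso_iff f

/-- The pullback of a frame is a frame. -/
theorem IsFrame.pullback (g : Y ⟶ X) {M : X.Modules} {U : X.Opens} {ι : Type} [Fintype ι]
    {e : ι → Γ(M, U)} (he : IsFrame M U e) :
    IsFrame ((Scheme.Modules.pullback g).obj M) (g ⁻¹ᵁ U) (fun i => pullSec g (e i)) := by
  -- Reduction to the global case: restrict to `g ⁻¹ᵁ U` and use that `(g ⁻¹ᵁ U).ι ≫ g` equals `(g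
  -- ∣_ U) ≫ U.ι`, with `e` a global frame on `U`.
  rw [← isFrame_pullSec_of_isOpenImmersion_iff (g ⁻¹ᵁ U).ι (by simp),
    ← isFrame_iso_iff (pullCompIso (g ⁻¹ᵁ U).ι g M)]
  have h1 : IsFrame ((Scheme.Modules.pullback U.ι).obj M) (U.ι ⁻¹ᵁ U)
      (fun i => pullSec U.ι (e i)) :=
    (isFrame_pullSec_of_isOpenImmersion_iff U.ι (by simp)).mpr he
  have h2 : IsFrame ((Scheme.Modules.pullback (g ∣_ U)).obj ((Scheme.Modules.pullback U.ι).obj M))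
      ((g ∣_ U) ⁻¹ᵁ U.ι ⁻¹ᵁ U) (fun i => pullSec (g ∣_ U) (pullSec U.ι (e i))) := by
    have aux (W : U.toScheme.Opens) (hW : W = ⊤)
        (e' : ι → Γ(((Scheme.Modules.pullback U.ι).obj M), W))
        (he' : IsFrame _ W e') : IsFrame ((Scheme.Modules.pullback (g ∣_ U)).obj
          ((Scheme.Modules.pullback U.ι).obj M)) ((g ∣_ U) ⁻¹ᵁ W)
            (fun i => pullSec (g ∣_ U) (e' i)) := by
      subst hW
      exact pullback_isFrame_top _ he'
    exact aux _ (by simp) _ h1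
  have h3 := h2.map_iso (pullCompIso (g ∣_ U) U.ι M)
  simp only [pullSec_comp] at h3 ⊢
  have aux (p q : (g ⁻¹ᵁ U).toScheme ⟶ X) (hpq : p = q)
      (h : IsFrame ((Scheme.Modules.pullback p).obj M) (p ⁻¹ᵁ U) (fun i => pullSec p (e i))) :
      IsFrame ((Scheme.Modules.pullback q).obj M) (q ⁻¹ᵁ U) (fun i => pullSec q (e i)) := hpq ▸ h
  exact aux _ _ (morphismRestrict_ι g U) h3

lemma IsLocallyFree.pullback (g : Y ⟶ X) {M : X.Modules} (hM : IsLocallyFree M) :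
    IsLocallyFree ((Scheme.Modules.pullback g).obj M) := by
  intro y
  obtain ⟨U, hU, n, e, he⟩ := hM (g y)
  exact ⟨g ⁻¹ᵁ U, hU, n, _, he.pullback g⟩

end Pullback

/-! ### Matrices under restriction and pullback -/

section MatrixOf

variable {X Y Z : Scheme.{u}} {E F : X.Modules} {φ : E ⟶ F} {U : X.Opens}
  {ι κ : Type} [Fintype ι] [Fintype κ] {e : ι → Γ(E, U)} {f : κ → Γ(F, U)}
  {A : Matrix κ ι Γ(X, U)}

lemma IsMatrixOf.res (hA : IsMatrixOf φ U e f A) {V : X.Opens} (h : V ≤ U) :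
    IsMatrixOf φ V (fun i => resM E h (e i)) (fun i => resM F h (f i)) (A.map (resO h)) := by
  refine ⟨hA.1.res h, hA.2.1.res h, fun j => ?_⟩
  have h1 := appM_resM φ h (e j)
  have h2 : appM φ U (e j) = ∑ i, A i j • f i := hA.2.2 j
  rw [h2, map_sum] at h1
  refine h1.trans (Finset.sum_congr rfl fun i _ => resM_smul _ _ _)

lemma IsMatrixOf.pullback (g : Y ⟶ X) (hA : IsMatrixOf φ U e f A) :
    IsMatrixOf (pullbackMap g φ) (g ⁻¹ᵁ U) (fun i => pullSec g (e i)) (fun i => pullSec g (f i))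
      (A.map (g.app U).hom) := by
  refine ⟨hA.1.pullback g, hA.2.1.pullback g, fun j => ?_⟩
  have h1 := pullSec_appM g φ (e j)
  have h2 : appM φ U (e j) = ∑ i, A i j • f i := hA.2.2 j
  rw [h2, pullSec_sum] at h1
  exact h1.trans (Finset.sum_congr rfl fun i _ => pullSec_smul _ _ _)

lemma IsMatrixOf.of_comp {h : Z ⟶ Y} {g : Y ⟶ X} {W : Z.Opens}
    {e : ι → Γ((Scheme.Modules.pullback h).obj ((Scheme.Modules.pullback g).obj E), W)}
    {f : κ → Γ((Scheme.Modules.pullback h).obj ((Scheme.Modules.pullback g).obj F), W)}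
    {A : Matrix κ ι Γ(Z, W)} (hA : IsMatrixOf (pullbackMap h (pullbackMap g φ)) W e f A) :
    IsMatrixOf (pullbackMap (h ≫ g) φ) W
      (fun i => appM (pullCompIso h g E).hom W (e i))
      (fun i => appM (pullCompIso h g F).hom W (f i)) A := by
  refine ⟨hA.1.map_iso (pullCompIso h g E),
    hA.2.1.map_iso (pullCompIso h g F), fun j => ?_⟩
  have h1 := pullCompIso_naturality h g φ
  have h2 : appM (pullbackMap (h ≫ g) φ) W
      (appM (pullCompIso h g E).hom W (e j)) =
      appM (pullCompIso h g F).hom W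
        (appM (pullbackMap h (pullbackMap g φ)) W (e j)) := congr(appM $h1 W (e j)).symm
  have h3 : appM (pullbackMap h (pullbackMap g φ)) W (e j) = ∑ i, A i j • f i := hA.2.2 j
  rw [h3, map_sum] at h2
  exact h2.trans (Finset.sum_congr rfl fun i _ => map_smul _ _ _)

end MatrixOf

/-! ### Ideals of minors over a ring -/

section MinorIdeal

variable {R S : Type*} [CommRing R] [CommRing S] {ι κ ι' κ' : Type*}

/-- The ideal generated by the minors of size `r + 1` of a matrix. -/
def minorIdeal (A : Matrix κ ι R) (r : ℕ) : Ideal R :=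
  Ideal.span (Set.range fun st : (Fin (r + 1) → κ) × (Fin (r + 1) → ι) =>
    (A.submatrix st.1 st.2).det)

lemma det_mem_minorIdeal (A : Matrix κ ι R) {r : ℕ} (s : Fin (r + 1) → κ) (t : Fin (r + 1) → ι) :
    (A.submatrix s t).det ∈ minorIdeal A r :=
  Ideal.subset_span ⟨(s, t), rfl⟩

lemma minorIdeal_le_iff {A : Matrix κ ι R} {r : ℕ} {I : Ideal R} :
    minorIdeal A r ≤ I ↔
      ∀ (s : Fin (r + 1) → κ) (t : Fin (r + 1) → ι), (A.submatrix s t).det ∈ I := by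
  simp [minorIdeal, Ideal.span_le, Set.range_subset_iff]

lemma map_minorIdeal (f : R →+* S) (A : Matrix κ ι R) (r : ℕ) :
    (minorIdeal A r).map f = minorIdeal (A.map f) r := by
  rw [minorIdeal, minorIdeal, Ideal.map_span, ← Set.range_comp]
  congr 2
  funext st
  exact RingHom.map_det f _

lemma minorIdeal_transpose (A : Matrix κ ι R) (r : ℕ) :
    minorIdeal A.transpose r = minorIdeal A r := by
  refine le_antisymm (minorIdeal_le_iff.mpr fun s t => ?_) (minorIdeal_le_iff.mpr fun s t => ?_)
  · rw [← Matrix.det_transpose]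
    exact det_mem_minorIdeal A t s
  · rw [← Matrix.det_transpose]
    exact det_mem_minorIdeal A.transpose t s

/-- The rows of `C * A` are combinations of rows of `A`, and the determinant is multilinear in the
rows. The expansion runs over all row selections, injective or not, which is why minors are indexed
by arbitrary maps. -/
lemma minorIdeal_mul_le_right [Fintype κ] (C : Matrix κ' κ R) (A : Matrix κ ι R) (r : ℕ) :
    minorIdeal (C * A) r ≤ minorIdeal A r := by
  classical
  refine minorIdeal_le_iff.mpr fun s t => ?_
  have h : ((C * A).submatrix s t).det = Matrix.detRowAlternating.toMultilinearMap
      (fun i : Fin (r + 1) => ∑ k, C (s i) k • (fun j => A k (t j))) := by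
    change Matrix.det _ = Matrix.det _
    congr 1
    ext i j
    simp [Matrix.mul_apply]
  rw [h, MultilinearMap.map_sum]
  refine Ideal.sum_mem _ fun k _ => ?_
  rw [MultilinearMap.map_smul_univ]
  exact Ideal.mul_mem_left _ _ (det_mem_minorIdeal A k t)

lemma minorIdeal_mul_le_left [Fintype ι] (A : Matrix κ ι R) (C : Matrix ι ι' R) (r : ℕ) :
    minorIdeal (A * C) r ≤ minorIdeal A r := by
  rw [← minorIdeal_transpose, Matrix.transpose_mul, ← minorIdeal_transpose A]
  exact minorIdeal_mul_le_right _ _ _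

end MinorIdeal

/-! ### Change of frames -/

section FrameChange

variable {X : Scheme.{u}} {E F : X.Modules} {φ : E ⟶ F} {U : X.Opens}
  {ι κ ι' κ' : Type} [Fintype ι] [Fintype κ] [Fintype ι'] [Fintype κ']
  {e : ι → Γ(E, U)} {f : κ → Γ(F, U)} {A : Matrix κ ι Γ(X, U)}
  {e' : ι' → Γ(E, U)} {f' : κ' → Γ(F, U)} {A' : Matrix κ' ι' Γ(X, U)}

lemma IsFrame.bijective (he : IsFrame E U e) :
    Function.Bijective (fun c : ι → Γ(X, U) => ∑ i, c i • e i) := by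
  simpa only [resM_self] using isFrame_iff.mp he U le_rfl

lemma IsFrame.exists_matrix {κ : Type} (he : IsFrame E U e) (s : κ → Γ(E, U)) :
    ∃ C : Matrix ι κ Γ(X, U), ∀ j, s j = ∑ i, C i j • e i := by
  choose C hC using fun j => he.bijective.2 (s j)
  exact ⟨fun i j => C j i, fun j => (hC j).symm⟩

lemma sum_mul_smul {s : κ → Γ(E, U)} {C : Matrix ι κ Γ(X, U)}
    (h : ∀ j, s j = ∑ i, C i j • e i) (c : κ → Γ(X, U)) :
    ∑ j, c j • s j = ∑ i, C.mulVec c i • e i := by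
  simp only [h, Finset.smul_sum, Matrix.mulVec, dotProduct, Finset.sum_smul, smul_smul]
  rw [Finset.sum_comm]
  simp only [mul_comm]

lemma IsMatrixOf.appM_sum (hA : IsMatrixOf φ U e f A) (c : ι → Γ(X, U)) :
    appM φ U (∑ j, c j • e j) = ∑ i, A.mulVec c i • f i := by
  rw [map_sum, ← sum_mul_smul (fun j => hA.2.2 j)]
  simp only [map_smul]
  rfl

/-- The transition matrices may be rectangular, since frames of different sizes coexist over the
zero ring. No inverses are needed: one such factorisation in each direction gives equal ideals of
minors. -/
lemma IsMatrixOf.exists_eq_mul (hA : IsMatrixOf φ U e f A) (hA' : IsMatrixOf φ U e' f' A') :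
    ∃ (G : Matrix κ' κ Γ(X, U)) (C : Matrix ι ι' Γ(X, U)), A' = G * A * C := by
  obtain ⟨C, hC⟩ := hA.1.exists_matrix e'
  obtain ⟨G, hG⟩ := hA'.2.1.exists_matrix f
  refine ⟨G, C, ?_⟩
  ext k j
  have h1 : appM φ U (e' j) = ∑ i, A' i j • f' i := hA'.2.2 j
  rw [hC, hA.appM_sum, sum_mul_smul hG] at h1
  have h2 := congrFun (hA'.2.1.bijective.1 h1) k
  rw [← h2, Matrix.mulVec_mulVec]
  rfl

lemma IsMatrixOf.minorIdeal_le (hA : IsMatrixOf φ U e f A) (hA' : IsMatrixOf φ U e' f' A')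
    (r : ℕ) : minorIdeal A' r ≤ minorIdeal A r := by
  obtain ⟨G, C, rfl⟩ := hA.exists_eq_mul hA'
  exact (minorIdeal_mul_le_left _ _ _).trans (minorIdeal_mul_le_right _ _ _)

lemma IsMatrixOf.minorIdeal_eq (hA : IsMatrixOf φ U e f A) (hA' : IsMatrixOf φ U e' f' A')
    (r : ℕ) : minorIdeal A' r = minorIdeal A r :=
  le_antisymm (hA.minorIdeal_le hA' r) (hA'.minorIdeal_le hA r)

lemma IsFrame.reindex (he : IsFrame E U e) (σ : ι' ≃ ι) : IsFrame E U (e ∘ σ) := by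
  rw [isFrame_iff] at he ⊢
  intro V hV
  have hb : Function.Bijective (fun (c : ι' → Γ(X, V)) => c ∘ σ.symm) :=
    (σ.arrowCongr (Equiv.refl _)).bijective
  convert (he V hV).comp hb using 2 with c
  refine (Fintype.sum_equiv σ _ _ fun i => ?_)
  simp

lemma IsMatrixOf.reindex (hA : IsMatrixOf φ U e f A) (σ : ι' ≃ ι) (τ : κ' ≃ κ) :
    IsMatrixOf φ U (e ∘ σ) (f ∘ τ) (A.submatrix τ σ) := by
  refine ⟨hA.1.reindex σ, hA.2.1.reindex τ, fun j => ?_⟩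
  refine (hA.2.2 (σ j)).trans ?_
  exact (Fintype.sum_equiv τ _ _ fun i => rfl).symm

lemma IsFrame.mul [DecidableEq ι] (he : IsFrame E U e) {P : Matrix ι ι Γ(X, U)} (hP : IsUnit P) :
    IsFrame E U (fun j => ∑ i, P i j • e i) := by
  rw [isFrame_iff] at he ⊢
  intro V hV
  have hP' : IsUnit (P.map (resO hV)) := hP.map (resO hV).mapMatrix
  have hb : Function.Bijective (P.map (resO hV)).mulVec :=
    ⟨Matrix.mulVec_injective_of_isUnit hP', Matrix.mulVec_surjective_iff_isUnit.mpr hP'⟩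
  convert (he V hV).comp hb using 2 with c
  refine sum_mul_smul (fun j => ?_) _
  rw [map_sum]
  exact Finset.sum_congr rfl fun i _ => resM_smul _ _ _

lemma IsMatrixOf.mul [DecidableEq ι] [DecidableEq κ] (hA : IsMatrixOf φ U e f A)
    {P : Matrix ι ι Γ(X, U)} (hP : IsUnit P) {Q : Matrix κ κ Γ(X, U)} (hQ : IsUnit Q)
    {B : Matrix κ ι Γ(X, U)} (h : A * P = Q * B) :
    IsMatrixOf φ U (fun j => ∑ i, P i j • e i) (fun j => ∑ i, Q i j • f i) B := by
  refine ⟨hA.1.mul hP, hA.2.1.mul hQ, fun j => ?_⟩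
  have h1 := hA.appM_sum (fun i => P i j)
  have h2 : A.mulVec (fun i => P i j) = Q.mulVec (fun i => B i j) :=
    funext fun k => congrFun (congrFun h k) j
  rw [h2, ← sum_mul_smul (fun _ => rfl)] at h1
  exact h1

end FrameChange

/-! ### Restriction to basic opens as localization -/

section Local

variable {X : Scheme.{u}}

lemma resO_mem_map_iff {V W : X.Opens} (hV : IsAffineOpen V) (h : W ≤ V) {f : Γ(X, V)}
    (hW : W = X.basicOpen f) {I : Ideal Γ(X, V)} {x : Γ(X, V)} :
    resO h x ∈ I.map (resO h) ↔ ∃ n : ℕ, f ^ n * x ∈ I := by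
  let : Algebra Γ(X, V) Γ(X, W) := (resO h).toAlgebra
  have : IsLocalization.Away f Γ(X, W) := hV.isLocalization_of_eq_basicOpen f (homOfLE h) hW
  have := IsLocalization.algebraMap_mem_map_algebraMap_iff (Submonoid.powers f) Γ(X, W) I x
  refine this.trans ?_
  simp [Submonoid.mem_powers_iff]

lemma exists_resO_pow_mul {V W : X.Opens} (hV : IsAffineOpen V) (h : W ≤ V) {f : Γ(X, V)}
    (hW : W = X.basicOpen f) (s : Γ(X, W)) :
    ∃ (n : ℕ) (a : Γ(X, V)), resO h a = resO h f ^ n * s := by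
  let : Algebra Γ(X, V) Γ(X, W) := (resO h).toAlgebra
  have : IsLocalization.Away f Γ(X, W) := hV.isLocalization_of_eq_basicOpen f (homOfLE h) hW
  obtain ⟨n, a, ha⟩ := IsLocalization.Away.surj f s
  exact ⟨n, a, ha.symm.trans (mul_comm _ _)⟩

lemma isUnit_resO {V W : X.Opens} (h : W ≤ V) {f : Γ(X, V)} (hW : W = X.basicOpen f) :
    IsUnit (resO h f) := by
  subst hW
  exact RingedSpace.isUnit_res_basicOpen _ f

lemma resO_mem_nonZeroDivisors {V W : X.Opens} (hV : IsAffineOpen V) (h : W ≤ V) {f : Γ(X, V)}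
    (hW : W = X.basicOpen f) {q : Γ(X, V)} (hq : q ∈ nonZeroDivisors Γ(X, V)) :
    resO h q ∈ nonZeroDivisors Γ(X, W) := by
  let : Algebra Γ(X, V) Γ(X, W) := (resO h).toAlgebra
  have : IsLocalization.Away f Γ(X, W) := hV.isLocalization_of_eq_basicOpen f (homOfLE h) hW
  exact IsLocalization.map_nonZeroDivisors_le (Submonoid.powers f) Γ(X, W) ⟨q, hq, rfl⟩

lemma mem_of_forall_resO_mem {V : X.Opens} (hV : IsAffineOpen V) {T : Set Γ(X, V)}
    (hT : Ideal.span T = ⊤) {I : Ideal Γ(X, V)} {x : Γ(X, V)}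
    (H : ∀ g ∈ T, resO (X.basicOpen_le g) x ∈ I.map (resO (X.basicOpen_le g))) : x ∈ I := by
  refine Submodule.mem_of_span_eq_top_of_smul_pow_mem I T hT x fun g => ?_
  exact (resO_mem_map_iff hV _ rfl).mp (H g.1 g.2)

lemma basicOpen_resO {V W : X.Opens} (h : W ≤ V) (f : Γ(X, V)) :
    X.basicOpen (resO h f) = W ⊓ X.basicOpen f :=
  Scheme.basicOpen_res _ _ _

end Local

/-! ### The determinantal ideal computed by one matrix -/

section DetIdeal

variable {X : Scheme.{u}} {E F : X.Modules} {φ : E ⟶ F}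

lemma exists_isMatrixOf (hE : IsLocallyFree E) (hF : IsLocallyFree F) (φ : E ⟶ F) (x : X)
    (U : X.Opens) (hx : x ∈ U) : ∃ W : X.Opens, IsAffineOpen W ∧ x ∈ W ∧ W ≤ U ∧
      ∃ (a b : ℕ) (e : Fin a → Γ(E, W)) (f : Fin b → Γ(F, W)) (A : Matrix (Fin b) (Fin a) Γ(X, W)),
        IsMatrixOf φ W e f A := by
  obtain ⟨U₁, hx₁, a, e, he⟩ := hE x
  obtain ⟨U₂, hx₂, b, f, hf⟩ := hF x
  obtain ⟨W, hW, hxW, hle⟩ := exists_isAffineOpen_mem_and_subset (x := x) (U := U ⊓ (U₁ ⊓ U₂))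
    ⟨hx, hx₁, hx₂⟩
  have hle' : W ≤ U ⊓ (U₁ ⊓ U₂) := hle
  have h₁ : W ≤ U₁ := hle'.trans (inf_le_right.trans inf_le_left)
  have h₂ : W ≤ U₂ := hle'.trans (inf_le_right.trans inf_le_right)
  obtain ⟨A, hA⟩ := (hf.res h₂).exists_matrix (fun j => appM φ W (resM E h₁ (e j)))
  exact ⟨W, hW, hxW, hle'.trans inf_le_left, a, b, _, _, A, he.res h₁, hf.res h₂, hA⟩

/-- The open subset `U` carries frames for the source and the target of `φ`. -/
def HasMatrix (φ : E ⟶ F) (U : X.Opens) : Prop :=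
  ∃ (a b : ℕ) (e : Fin a → Γ(E, U)) (f : Fin b → Γ(F, U)) (A : Matrix (Fin b) (Fin a) Γ(X, U)),
    IsMatrixOf φ U e f A

lemma HasMatrix.res {U V : X.Opens} (h : HasMatrix φ U) (hV : V ≤ U) : HasMatrix φ V := by
  obtain ⟨a, b, e, f, A, hA⟩ := h
  exact ⟨a, b, _, _, _, hA.res hV⟩

lemma span_hasMatrix_basicOpen (hE : IsLocallyFree E) (hF : IsLocallyFree F) (φ : E ⟶ F)
    {V : X.Opens} (hV : IsAffineOpen V) :
    Ideal.span {g : Γ(X, V) | HasMatrix φ (X.basicOpen g)} = ⊤ := by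
  rw [← hV.self_le_iSup_basicOpen_iff]
  intro x hx
  obtain ⟨W, -, hxW, -, hW⟩ := exists_isMatrixOf hE hF φ x V hx
  obtain ⟨g, hg, hxg⟩ := hV.exists_basicOpen_le ⟨x, hxW⟩ hx
  exact TopologicalSpace.Opens.mem_iSup.mpr ⟨⟨g, HasMatrix.res hW hg⟩, hxg⟩

/-- The functions over `V` that lie in the ideal of minors wherever `φ` has a matrix. -/
def minorSections (φ : E ⟶ F) (r : ℕ) (V : X.Opens) : Ideal Γ(X, V) :=
  sInf {I | ∃ (W : X.Opens) (h : W ≤ V) (a b : ℕ) (e : Fin a → Γ(E, W)) (f : Fin b → Γ(F, W))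
    (A : Matrix (Fin b) (Fin a) Γ(X, W)), IsAffineOpen W ∧ IsMatrixOf φ W e f A ∧
    I = (minorIdeal A r).comap (resO h)}

lemma mem_minorSections {r : ℕ} {V : X.Opens} {s : Γ(X, V)} : s ∈ minorSections φ r V ↔
    ∀ (W : X.Opens) (h : W ≤ V) (a b : ℕ) (e : Fin a → Γ(E, W)) (f : Fin b → Γ(F, W))
      (A : Matrix (Fin b) (Fin a) Γ(X, W)), IsAffineOpen W → IsMatrixOf φ W e f A →
      resO h s ∈ minorIdeal A r := by
  simp only [minorSections, Submodule.mem_sInf, Set.mem_ofPred_eq]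
  constructor
  · intro H W h a b e f A hW hA
    exact H _ ⟨W, h, a, b, e, f, A, hW, hA, rfl⟩
  · rintro H _ ⟨W, h, a, b, e, f, A, hW, hA, rfl⟩
    exact H W h a b e f A hW hA

lemma map_minorSections_le (φ : E ⟶ F) (r : ℕ) {V V' : X.Opens} (h : V' ≤ V) :
    (minorSections φ r V).map (resO h) ≤ minorSections φ r V' := by
  rw [Ideal.map_le_iff_le_comap]
  intro s hs
  rw [Ideal.mem_comap, mem_minorSections]
  intro W hW a b e f A hWa hA
  rw [resO_resO]
  exact mem_minorSections.mp hs W _ a b e f A hWa hA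

/-- This is quasi-coherence, proved by clearing denominators: `f ^ n * s` lifts to `a` on `V`, a
further power of `f` brings `a` into the minors on each of finitely many trivialising basic opens,
and `f` is a unit on `X.basicOpen f`. -/
lemma map_minorSections_basicOpen (hE : IsLocallyFree E) (hF : IsLocallyFree F) (φ : E ⟶ F)
    (r : ℕ) {V : X.Opens} (hV : IsAffineOpen V) (f : Γ(X, V)) :
    (minorSections φ r V).map (resO (X.basicOpen_le f)) = minorSections φ r (X.basicOpen f) := by
  refine le_antisymm (map_minorSections_le _ _ _) fun s hs => ?_
  obtain ⟨n, a, ha⟩ := exists_resO_pow_mul hV (X.basicOpen_le f) rfl s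
  obtain ⟨t, htS, ht⟩ :=
    (Ideal.span_eq_top_iff_finite _).mp (span_hasMatrix_basicOpen hE hF φ hV)
  -- The exponent is uniform in the matrix and valid for all larger `M`, so the supremum over the
  -- finite cover serves every member at once.
  have key (g : Γ(X, V)) (hg : HasMatrix φ (X.basicOpen g)) :
      ∃ N : ℕ, ∀ M ≥ N, ∀ (p q : ℕ) (e : Fin p → Γ(E, X.basicOpen g))
        (f' : Fin q → Γ(F, X.basicOpen g)) (A : Matrix (Fin q) (Fin p) Γ(X, X.basicOpen g)),
        IsMatrixOf φ (X.basicOpen g) e f' A →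
        resO (X.basicOpen_le g) (f ^ M * a) ∈ minorIdeal A r := by
    obtain ⟨p, q, e, f', A, hA⟩ := hg
    have hle : X.basicOpen g ⊓ X.basicOpen f ≤ X.basicOpen g := inf_le_left
    have hDa : IsAffineOpen (X.basicOpen g ⊓ X.basicOpen f) := by
      rw [← basicOpen_resO (X.basicOpen_le g)]
      exact (hV.basicOpen g).basicOpen _
    have h1 := mem_minorSections.mp hs (X.basicOpen g ⊓ X.basicOpen f) inf_le_right _ _ _ _ _ hDa
      (hA.res hle)
    rw [← map_minorIdeal] at h1
    have h2 : resO hle (resO (X.basicOpen_le g) a) ∈ (minorIdeal A r).map (resO hle) := by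
      have h3 := congrArg (resO (inf_le_right : X.basicOpen g ⊓ X.basicOpen f ≤ X.basicOpen f)) ha
      rw [resO_resO, map_mul] at h3
      rw [resO_resO, h3]
      exact Ideal.mul_mem_left _ _ h1
    obtain ⟨N, hN⟩ := (resO_mem_map_iff (hV.basicOpen g) hle
      (basicOpen_resO (X.basicOpen_le g) f).symm).mp h2
    refine ⟨N, fun M hM p' q' e' f'' A' hA' => ?_⟩
    obtain ⟨k, rfl⟩ := Nat.exists_eq_add_of_le' hM
    rw [hA.minorIdeal_eq hA', map_mul, map_pow, pow_add, mul_assoc]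
    exact Ideal.mul_mem_left _ _ hN
  choose! N hN using key
  set M := t.sup N
  have hb : f ^ M * a ∈ minorSections φ r V := by
    rw [mem_minorSections]
    intro W h p q e f' A hW hA
    have hT : Ideal.span (resO h '' t) = ⊤ := by
      rw [← Ideal.map_span, ht, Ideal.map_top]
    refine mem_of_forall_resO_mem hW hT ?_
    rintro _ ⟨g, hg, rfl⟩
    obtain ⟨p', q', e', f'', A', hA'⟩ := htS hg
    have h1 := hN g (htS hg) M (Finset.le_sup hg) _ _ _ _ _ hA'
    have hle : X.basicOpen (resO h g) ≤ X.basicOpen g := by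
      rw [basicOpen_resO]; exact inf_le_right
    rw [map_minorIdeal, (hA'.res hle).minorIdeal_eq (hA.res (X.basicOpen_le (resO h g))),
      ← map_minorIdeal, resO_resO]
    have h2 := Ideal.mem_map_of_mem (resO hle) h1
    rwa [resO_resO] at h2
  have hu := isUnit_resO (X.basicOpen_le f) rfl
  have h1 := Ideal.mem_map_of_mem (resO (X.basicOpen_le f)) hb
  rw [map_mul, map_pow, ha] at h1
  exact (Ideal.unit_mul_mem_iff_mem _ (hu.pow n)).mp
    ((Ideal.unit_mul_mem_iff_mem _ (hu.pow M)).mp h1)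

/-- The ideal sheaf of minors. -/
noncomputable def minorIdealSheaf (hE : IsLocallyFree E) (hF : IsLocallyFree F) (φ : E ⟶ F)
    (r : ℕ) : X.IdealSheafData where
  ideal U := minorSections φ r U.1
  map_ideal_basicOpen U f := map_minorSections_basicOpen hE hF φ r U.2 f

lemma IsMatrixOf.minorSections_eq {r : ℕ} {U : X.Opens} (hU : IsAffineOpen U) {a b : ℕ}
    {e : Fin a → Γ(E, U)} {f : Fin b → Γ(F, U)} {A : Matrix (Fin b) (Fin a) Γ(X, U)}
    (hA : IsMatrixOf φ U e f A) : minorSections φ r U = minorIdeal A r := by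
  refine le_antisymm (fun s hs => ?_) (fun s hs => ?_)
  · simpa using mem_minorSections.mp hs U le_rfl _ _ _ _ _ hU hA
  · rw [mem_minorSections]
    intro W h a' b' e' f' A' hW hA'
    rw [(hA.res h).minorIdeal_eq hA', ← map_minorIdeal]
    exact Ideal.mem_map_of_mem _ hs

/-- The sheaf of minors is a member of the family defining `detIdeal`. It is the least one, because
inclusion of ideal sheaves can be tested on an affine cover carrying frames, where it is generated
by minors. -/
theorem detIdeal_eq_minorIdealSheaf (hE : IsLocallyFree E) (hF : IsLocallyFree F) (φ : E ⟶ F)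
    (r : ℕ) : detIdeal φ r = minorIdealSheaf hE hF φ r := by
  refine IsLeast.csInf_eq ⟨?_, ?_⟩
  · intro U a b e f A hA s t
    change _ ∈ minorSections φ r U.1
    rw [hA.minorSections_eq U.2]
    exact det_mem_minorIdeal A s t
  · intro J hJ
    choose W hW hxW hWt a b e f A hA using fun x => exists_isMatrixOf hE hF φ x ⊤ trivial
    refine Scheme.IdealSheafData.le_of_iSup_eq_top (fun x => (⟨W x, hW x⟩ : X.affineOpens)) ?_ ?_
    · rw [eq_top_iff]
      intro x _
      exact TopologicalSpace.Opens.mem_iSup.mpr ⟨x, hxW x⟩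
    · intro x
      change minorSections φ r (W x) ≤ _
      rw [(hA x).minorSections_eq (hW x), minorIdeal_le_iff]
      exact hJ ⟨W x, hW x⟩ _ _ _ _ _ (hA x)

/-- The determinantal ideal is computed by any matrix. -/
theorem IsMatrixOf.detIdeal_eq (hE : IsLocallyFree E) (hF : IsLocallyFree F) {r : ℕ}
    {U : X.affineOpens} {ι κ : Type} [Fintype ι] [Fintype κ] {e : ι → Γ(E, U.1)}
    {f : κ → Γ(F, U.1)} {A : Matrix κ ι Γ(X, U.1)} (hA : IsMatrixOf φ U.1 e f A) :
    (detIdeal φ r).ideal U = minorIdeal A r := by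
  rw [detIdeal_eq_minorIdealSheaf hE hF]
  have hA' := hA.reindex (Fintype.equivFin ι).symm (Fintype.equivFin κ).symm
  change minorSections φ r U.1 = _
  rw [hA'.minorSections_eq U.2, hA.minorIdeal_eq hA']

end DetIdeal

/-! ### Inverse image ideals on affine opens -/

section Comap

variable {X Y : Scheme.{u}}

/-- Pullback of functions along `g`, restricted to an open subset of the preimage. -/
noncomputable def pullO (g : Y ⟶ X) {U : X.Opens} {V : Y.Opens} (h : V ≤ g ⁻¹ᵁ U) :
    Γ(X, U) →+* Γ(Y, V) := (resO h).comp (g.app U).hom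

lemma pullO_eq_appLE (g : Y ⟶ X) {U : X.Opens} {V : Y.Opens} (h : V ≤ g ⁻¹ᵁ U) :
    pullO g h = (g.appLE U V h).hom := rfl

/-- Both inclusions come from the adjunction between `comap` and `map` of ideal sheaves, since `map`
along an affine morphism is contraction of ideals. -/
lemma ideal_comap_top [IsAffine X] [IsAffine Y] (g : Y ⟶ X) (I : X.IdealSheafData) :
    (I.comap g).ideal ⟨⊤, isAffineOpen_top Y⟩ =
      (I.ideal ⟨⊤, isAffineOpen_top X⟩).map (g.appTop).hom := by
  have hmap (J : Y.IdealSheafData) : (J.map g).ideal ⟨⊤, isAffineOpen_top X⟩ =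
      (J.ideal ⟨⊤, isAffineOpen_top Y⟩).comap g.appTop.hom :=
    Scheme.IdealSheafData.ideal_map_of_isAffineHom J g ⟨⊤, isAffineOpen_top X⟩
  refine le_antisymm ?_ ?_
  · have h : I.comap g ≤ Scheme.IdealSheafData.ofIdealTop
        ((I.ideal ⟨⊤, isAffineOpen_top X⟩).map (g.appTop).hom) := by
      rw [← Scheme.IdealSheafData.le_map_iff_comap_le]
      refine Scheme.IdealSheafData.le_of_isAffine ?_
      rw [hmap, ← Ideal.map_le_iff_le_comap]
      simp
    simpa using h ⟨⊤, isAffineOpen_top Y⟩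
  · rw [Ideal.map_le_iff_le_comap, ← hmap]
    exact Scheme.IdealSheafData.le_map_iff_comap_le.mpr le_rfl _

lemma pullO_ι (U : X.Opens) :
    pullO U.ι (U := U) (V := ⊤) (by simp) = resO (X := X) (V := U.ι ''ᵁ ⊤) (by simp) := by
  rw [pullO_eq_appLE, Scheme.Opens.ι_appLE]
  rfl

lemma ideal_comap_ι (I : X.IdealSheafData) (U : X.affineOpens) :
    haveI : IsAffine U.1 := U.2
    (I.comap U.1.ι).ideal ⟨⊤, isAffineOpen_top _⟩ =
      (I.ideal U).map (pullO U.1.ι (V := ⊤) (by simp)) := by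
  have : IsAffine U.1 := U.2
  have h : U.1.ι ''ᵁ ⊤ ≤ U.1 := by simp
  have h2 := I.map_ideal (U := ⟨U.1.ι ''ᵁ ⊤, (isAffineOpen_top _).image_of_isOpenImmersion _⟩)
    (V := U) h
  rw [Scheme.IdealSheafData.ideal_comap_of_isOpenImmersion, Scheme.Opens.ι_appIso, pullO_ι]
  exact (Ideal.comap_id _).trans h2.symm

lemma ideal_comap (g : Y ⟶ X) (I : X.IdealSheafData) (U : X.affineOpens) (V : Y.affineOpens)
    (h : V.1 ≤ g ⁻¹ᵁ U.1) : (I.comap g).ideal V = (I.ideal U).map (pullO g h) := by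
  have : IsAffine U.1 := U.2
  have : IsAffine V.1 := V.2
  have h1 := ideal_comap_ι (I.comap g) V
  -- Compute the inverse image on `V` along `V ⟶ Y ⟶ X` and along `V ⟶ U ⟶ X`; the second route
  -- passes through affine schemes.
  rw [← Scheme.IdealSheafData.comap_comp, ← Scheme.Hom.resLE_comp_ι g h,
    Scheme.IdealSheafData.comap_comp, ideal_comap_top, ideal_comap_ι, Ideal.map_map] at h1
  have h2 : (Scheme.Hom.appTop (g.resLE U.1 V.1 h)).hom.comp (pullO U.1.ι (V := ⊤) (by simp)) =
      (pullO V.1.ι (V := ⊤) (by simp)).comp (pullO g h) := by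
    have e1 := Scheme.Hom.appLE_comp_appLE (g.resLE U.1 V.1 h) U.1.ι U.1 ⊤ ⊤ (by simp) le_top
    have e2 := Scheme.Hom.appLE_comp_appLE V.1.ι g U.1 V.1 ⊤ h (by simp)
    have e3 : (g.resLE U.1 V.1 h).appLE ⊤ ⊤ le_top = (g.resLE U.1 V.1 h).appTop :=
      Scheme.Hom.appLE_eq_app _
    simp only [Scheme.Hom.resLE_comp_ι, e3] at e1
    exact congrArg CommRingCat.Hom.hom (e1.trans e2.symm)
  rw [h2, ← Ideal.map_map] at h1
  have h3 : Function.Bijective (pullO V.1.ι (V := ⊤) (U := V.1) (by simp)) := by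
    rw [pullO_ι]
    exact V.1.topIso.symm.commRingCatIsoToRingEquiv.bijective
  have h4 := congrArg (Ideal.comap (pullO V.1.ι (V := ⊤) (U := V.1) (by simp))) h1
  rw [Ideal.comap_map_of_bijective _ h3, Ideal.comap_map_of_bijective _ h3] at h4
  exact h4.symm

end Comap

/-! ### Minors and pivoting for block diagonal matrices -/

section DiagMatrix

variable {R S : Type*} [CommRing R] [CommRing S] {ι κ : Type*} {n : ℕ}

/-- The block diagonal matrix with a diagonal block `p` and a block `B`. -/
abbrev diagBlock (p : Fin n → R) (B : Matrix κ ι R) : Matrix (Fin n ⊕ κ) (Fin n ⊕ ι) R :=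
  Matrix.fromBlocks (Matrix.diagonal p) 0 0 B

lemma diagBlock_map (f : R →+* S) (p : Fin n → R) (B : Matrix κ ι R) :
    (diagBlock p B).map f = diagBlock (fun i => f (p i)) (B.map f) := by
  rw [diagBlock, Matrix.fromBlocks_map, Matrix.diagonal_map (map_zero f),
    Matrix.map_zero _ (map_zero f), Matrix.map_zero _ (map_zero f)]

/-- The ideal generated by the entries of a matrix. -/
def entryIdeal (B : Matrix κ ι R) : Ideal R :=
  Ideal.span (Set.range fun kj : κ × ι => B kj.1 kj.2)

lemma entry_mem (B : Matrix κ ι R) (k : κ) (j : ι) : B k j ∈ entryIdeal B :=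
  Ideal.subset_span ⟨(k, j), rfl⟩

/-- One term of a minor: `f i` is the factor taken from row `s i`. By counting, some row `i₀` lies
in the second block and supplies the element of `J`; the other `n` factors together are divisible by
`∏ p`. -/
lemma prod_mem_of_injective {p : Fin n → R} {J : Ideal R} {f : Fin (n + 1) → R}
    {s : Fin (n + 1) → Fin n ⊕ κ} (hs : Function.Injective s)
    (h₁ : ∀ i k, s i = Sum.inl k → p k ∣ f i)
    (h₂ : ∀ i k, s i = Sum.inr k → f i ∈ J ∧ ∀ l, p l ∣ f i) :
    ∏ i, f i ∈ Ideal.span {∏ i, p i} * J := by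
  obtain ⟨i₀, k₀, h₀⟩ : ∃ i₀ k₀, s i₀ = Sum.inr k₀ := by
    by_contra! h
    have h' (i) : ∃ l, s i = Sum.inl l := by
      rcases hi : s i with l | k
      · exact ⟨l, rfl⟩
      · exact absurd hi (h i k)
    choose g hg using h'
    have : Function.Injective g := fun i j hij => hs (by rw [hg, hg, hij])
    simpa using Fintype.card_le_of_injective g this
  -- Only the values at first-block rows matter: there `f₀` is injective and extends to a
  -- permutation `g`. The remaining rows are divisible by every `p l`, so any index may be assigned
  -- to them.
  let f₀ : Fin n → Fin n := fun j => Sum.elim id (fun _ => j) (s (i₀.succAbove j))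
  obtain ⟨g, hg⟩ := Finset.exists_equiv_extend_of_card_eq (α := Fin n) (β := Fin n)
    (t := Finset.univ) (by simp)
    (s := Finset.univ.filter fun j => (s (i₀.succAbove j)).isLeft) (f := f₀)
    (Finset.subset_univ _) (by
      intro i hi j hj hij
      obtain ⟨k, hk⟩ := Sum.isLeft_iff.mp (Finset.mem_filter.mp hi).2
      obtain ⟨l, hl⟩ := Sum.isLeft_iff.mp (Finset.mem_filter.mp hj).2
      simp only [f₀, hk, hl, Sum.elim_inl, id] at hij
      subst hij
      exact Fin.succAbove_right_injective (hs (hk.trans hl.symm)))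
  have hdvd (j : Fin n) : p (g j) ∣ f (i₀.succAbove j) := by
    rcases hj : s (i₀.succAbove j) with k | k
    · have := hg j (by simp [hj])
      rw [this]
      simpa [f₀, hj] using h₁ _ _ hj
    · exact (h₂ _ _ hj).2 _
  have hP : ∏ i, p i = ∏ j, p (g j) :=
    (Fintype.prod_equiv (g.trans (Equiv.subtypeUnivEquiv Finset.mem_univ)) _ _
      fun j => rfl).symm
  obtain ⟨c, hc⟩ := Finset.prod_dvd_prod_of_dvd _ _ fun j (_ : j ∈ Finset.univ) => hdvd j
  rw [Fin.prod_univ_succAbove f i₀, hc, ← hP, Ideal.mem_span_singleton_mul]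
  exact ⟨c * f i₀, Ideal.mul_mem_left _ _ (h₂ _ _ h₀).1, by ring⟩

lemma minorIdeal_diagBlock_le {p : Fin n → R} {B : Matrix κ ι R}
    (hB : ∀ i k j, p i ∣ B k j) :
    minorIdeal (diagBlock p B) n ≤ Ideal.span {∏ i, p i} * entryIdeal B := by
  refine minorIdeal_le_iff.mpr fun s t => ?_
  by_cases hs : Function.Injective s
  · rw [Matrix.det_apply]
    refine Ideal.sum_mem _ fun σ _ => ?_
    rw [Units.smul_def, zsmul_eq_mul]
    refine Ideal.mul_mem_left _ _ ?_
    refine prod_mem_of_injective (s := s ∘ σ) (hs.comp σ.injective) ?_ ?_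
    · intro i k hk
      have hk' : s (σ i) = Sum.inl k := hk
      rw [Matrix.submatrix_apply, hk']
      rcases t i with l | l
      · by_cases hkl : k = l
        · simp [hkl]
        · simp [hkl]
      · simp
    · intro i k hk
      have hk' : s (σ i) = Sum.inr k := hk
      rw [Matrix.submatrix_apply, hk']
      rcases t i with l | l
      · simp
      · simpa using ⟨entry_mem B k l, fun i => hB i k l⟩
  · obtain ⟨i, j, hij, hne⟩ : ∃ i j, s i = s j ∧ i ≠ j := by
      simpa [Function.Injective] using hs
    rw [Matrix.det_zero_of_row_eq hne (by funext l; simp [hij])]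
    exact Ideal.zero_mem _

lemma prod_mul_mem_minorIdeal (p : Fin n → R) (B : Matrix κ ι R) (k : κ) (j : ι) :
    (∏ i, p i) * B k j ∈ minorIdeal (diagBlock p B) n := by
  have h : (∏ i, p i) * B k j = ((diagBlock p B).submatrix
      (Sum.map id (fun _ => k) ∘ finSumFinEquiv (m := n) (n := 1).symm)
      (Sum.map id (fun _ => j) ∘ finSumFinEquiv (m := n) (n := 1).symm)).det := by
    rw [← Matrix.submatrix_submatrix, Matrix.det_submatrix_equiv_self]
    have : (diagBlock p B).submatrix (Sum.map id fun _ : Fin 1 => k) (Sum.map id fun _ => j) =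
        Matrix.fromBlocks (Matrix.diagonal p) 0 0 (Matrix.of fun _ _ : Fin 1 => B k j) := by
      ext (i | i) (l | l) <;> rfl
    rw [this, Matrix.det_fromBlocks_zero₁₂, Matrix.det_diagonal, Matrix.det_unique]
    rfl
  rw [h]
  exact det_mem_minorIdeal _ _ _

/-- If the minors of a block diagonal matrix generate an invertible principal ideal, then so do
the entries of its last block. -/
lemma exists_entry_factor {p : Fin n → R} {B : Matrix κ ι R} (hB : ∀ i k j, p i ∣ B k j)
    {q : R} (hq : q ∈ nonZeroDivisors R) (h : minorIdeal (diagBlock p B) n = Ideal.span {q}) :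
    (∀ i, p i ∈ nonZeroDivisors R) ∧ ∃ s ∈ nonZeroDivisors R, (∀ i, p i ∣ s) ∧
      ∃ c : Matrix κ ι R, (∀ k j, B k j = s * c k j) ∧ entryIdeal c = ⊤ := by
  have h1 : q ∈ Ideal.span {∏ i, p i} * entryIdeal B :=
    minorIdeal_diagBlock_le hB (h ▸ Ideal.mem_span_singleton_self q)
  obtain ⟨s, hs, rfl⟩ := Ideal.mem_span_singleton_mul.mp h1
  obtain ⟨hP, hs'⟩ := mul_mem_nonZeroDivisors.mp hq
  have hc (k : κ) (j : ι) : ∃ c, B k j = s * c := by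
    have h2 := prod_mul_mem_minorIdeal p B k j
    rw [h, Ideal.mem_span_singleton] at h2
    obtain ⟨c, hc⟩ := h2
    exact ⟨c, (mul_cancel_left_mem_nonZeroDivisors hP).mp (by rw [hc, mul_assoc])⟩
  choose c hc using hc
  refine ⟨fun i => ?_, s, hs', fun i => ?_, Matrix.of c, hc, ?_⟩
  · obtain ⟨d, hd⟩ := Finset.dvd_prod_of_mem p (Finset.mem_univ i)
    rw [hd] at hP
    exact (mul_mem_nonZeroDivisors.mp hP).1
  · rw [← Ideal.mem_span_singleton]
    refine (Ideal.span_le.mpr ?_ : entryIdeal B ≤ _) hs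
    rintro _ ⟨⟨k, j⟩, rfl⟩
    exact Ideal.mem_span_singleton.mpr (hB i k j)
  · have h3 : entryIdeal B ≤ Ideal.span {s} * entryIdeal (Matrix.of c) := by
      refine Ideal.span_le.mpr ?_
      rintro _ ⟨⟨k, j⟩, rfl⟩
      exact Ideal.mem_span_singleton_mul.mpr
        ⟨c k j, entry_mem (Matrix.of c) k j, (hc k j).symm⟩
    obtain ⟨x, hx, hsx⟩ := Ideal.mem_span_singleton_mul.mp (h3 hs)
    have : x = 1 := (mul_cancel_left_mem_nonZeroDivisors hs').mp (by rw [hsx, mul_one])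
    rwa [this, ← Ideal.eq_top_iff_one] at hx

lemma exists_pivot {ι κ : Type*} [Fintype ι] [DecidableEq ι] [Fintype κ] [DecidableEq κ]
    (B : Matrix (Fin 1 ⊕ κ) (Fin 1 ⊕ ι) R)
    (hB : ∀ k j, B (Sum.inl 0) (Sum.inl 0) ∣ B k j) :
    ∃ (P : Matrix (Fin 1 ⊕ ι) (Fin 1 ⊕ ι) R) (Q : Matrix (Fin 1 ⊕ κ) (Fin 1 ⊕ κ) R)
      (B' : Matrix κ ι R), IsUnit P ∧ IsUnit Q ∧
      B * P = Q * (diagBlock (fun _ => B (Sum.inl 0) (Sum.inl 0)) B' :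
        Matrix (Fin 1 ⊕ κ) (Fin 1 ⊕ ι) R) ∧
      ∀ k j, B (Sum.inl 0) (Sum.inl 0) ∣ B' k j := by
  choose c hc using hB
  set x := B (Sum.inl 0) (Sum.inl 0) with hx
  -- `P` clears the pivot row, the inverse of `Q` clears the pivot column, and the last block is the
  -- Schur complement, visibly a multiple of `x`.
  refine ⟨Matrix.fromBlocks 1 (Matrix.of fun _ j => -c (Sum.inl 0) (Sum.inr j)) 0 1,
    Matrix.fromBlocks 1 0 (Matrix.of fun k _ => c (Sum.inr k) (Sum.inl 0)) 1,
    Matrix.of fun k j => x * (c (Sum.inr k) (Sum.inr j) -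
      c (Sum.inr k) (Sum.inl 0) * c (Sum.inl 0) (Sum.inr j)), ?_, ?_, ?_, fun k j => ⟨_, rfl⟩⟩
  · rw [Matrix.isUnit_iff_isUnit_det, Matrix.det_fromBlocks_zero₂₁]
    simp
  · rw [Matrix.isUnit_iff_isUnit_det, Matrix.det_fromBlocks_zero₁₂]
    simp
  -- The corner stays `x`, not `x * c _ _`: the chosen cofactor need not be `1` when `x` is a zero
  -- divisor.
  · have hBb : B = Matrix.fromBlocks (Matrix.of fun _ _ => x)
        (Matrix.of fun _ j => x * c (Sum.inl 0) (Sum.inr j))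
        (Matrix.of fun k _ => x * c (Sum.inr k) (Sum.inl 0))
        (Matrix.of fun k j => x * c (Sum.inr k) (Sum.inr j)) := by
      ext (i | i) (j | j)
      · rw [Subsingleton.elim i 0, Subsingleton.elim j 0]; rfl
      · rw [Subsingleton.elim i 0]; exact hc _ _
      · rw [Subsingleton.elim j 0]; exact hc _ _
      · exact hc _ _
    rw [hBb, diagBlock, Matrix.fromBlocks_multiply, Matrix.fromBlocks_multiply]
    congr 1 <;> ext i j <;>
      simp [Matrix.mul_apply, Matrix.diagonal, Subsingleton.elim _ (0 : Fin 1)] <;> ring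

lemma exists_equiv_sum_of_mem {a : ℕ} (j₀ : Fin a) :
    ∃ (a' : ℕ) (σ : Fin 1 ⊕ Fin a' ≃ Fin a), σ (Sum.inl 0) = j₀ := by
  obtain ⟨a', rfl⟩ : ∃ a', a = 1 + a' := ⟨a - 1, by have := j₀.2; omega⟩
  exact ⟨a', finSumFinEquiv.trans (Equiv.swap (finSumFinEquiv (Sum.inl 0)) j₀), by simp⟩

/-- Moving the first index of the second block to the end of the first block. -/
def snocEquiv (n a : ℕ) : Fin (n + 1) ⊕ Fin a ≃ Fin n ⊕ (Fin 1 ⊕ Fin a) :=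
  (Equiv.sumCongr finSumFinEquiv.symm (Equiv.refl _)).trans (Equiv.sumAssoc _ _ _)

lemma diagBlock_diagBlock_submatrix {a b : ℕ} (p : Fin n → R) (x : R)
    (B : Matrix (Fin b) (Fin a) R) :
    (diagBlock p (diagBlock (fun _ : Fin 1 => x) B)).submatrix (snocEquiv n b) (snocEquiv n a) =
      diagBlock (Fin.snoc (α := fun _ => R) p x) B := by
  have h (m : ℕ) (i : Fin n) : snocEquiv n m (Sum.inl i.castSucc) = Sum.inl i := by
    have : finSumFinEquiv.symm i.castSucc = (Sum.inl i : Fin n ⊕ Fin 1) :=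
      finSumFinEquiv_symm_apply_castAdd i
    simp [snocEquiv, this]
  have h' (m : ℕ) : snocEquiv n m (Sum.inl (Fin.last n)) = Sum.inr (Sum.inl 0) := by
    have : finSumFinEquiv.symm (Fin.last n) = (Sum.inr 0 : Fin n ⊕ Fin 1) :=
      finSumFinEquiv_symm_apply_natAdd (m := n) (0 : Fin 1)
    simp [snocEquiv, this]
  have h'' (m : ℕ) (i : Fin m) : snocEquiv n m (Sum.inr i) = Sum.inr (Sum.inr i) := rfl
  ext (i | i) (j | j)
  · induction i using Fin.lastCases <;> induction j using Fin.lastCases <;>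
      simp [h, h', Matrix.diagonal_apply]
    · intro hh; exact absurd hh.symm (Fin.castSucc_ne_last _)
  · induction i using Fin.lastCases <;> simp [h, h', h'']
  · induction j using Fin.lastCases <;> simp [h, h', h'']
  · simp [h'']

end DiagMatrix

/-! ### The inductive step and the iterated blowup -/

section Step

variable {X Y : Scheme.{u}} {E F : X.Modules} {φ : E ⟶ F}

/-- The map `φ` has a matrix `diag(p_1, …, p_n, B)` over `U`, where the `p_i` are nonzerodivisors,
each dividing the following ones as well as `B`. -/
def HasDiagBlock (φ : E ⟶ F) (n : ℕ) (U : X.Opens) : Prop :=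
  ∃ (a b : ℕ) (e : Fin n ⊕ Fin a → Γ(E, U)) (f : Fin n ⊕ Fin b → Γ(F, U))
    (p : Fin n → Γ(X, U)) (B : Matrix (Fin b) (Fin a) Γ(X, U)),
    IsMatrixOf φ U e f (diagBlock p B) ∧ (∀ i, p i ∈ nonZeroDivisors Γ(X, U)) ∧
    (∀ i j, i ≤ j → p i ∣ p j) ∧ (∀ i k j, p i ∣ B k j)

lemma IsMatrixOf.exists_snoc {U : X.Opens} {n a b : ℕ} {e : Fin n ⊕ Fin a → Γ(E, U)}
    {f : Fin n ⊕ Fin b → Γ(F, U)} {p : Fin n → Γ(X, U)} {B : Matrix (Fin b) (Fin a) Γ(X, U)}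
    (h : IsMatrixOf φ U e f (diagBlock p B)) (k₀ : Fin b) (j₀ : Fin a)
    (hB : ∀ k j, B k₀ j₀ ∣ B k j) :
    ∃ (a' b' : ℕ) (e' : Fin (n + 1) ⊕ Fin a' → Γ(E, U)) (f' : Fin (n + 1) ⊕ Fin b' → Γ(F, U))
      (B' : Matrix (Fin b') (Fin a') Γ(X, U)),
      IsMatrixOf φ U e' f' (diagBlock (Fin.snoc (α := fun _ => Γ(X, U)) p (B k₀ j₀)) B') ∧
      ∀ k j, B k₀ j₀ ∣ B' k j := by
  obtain ⟨a', σ, rfl⟩ := exists_equiv_sum_of_mem j₀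
  obtain ⟨b', τ, rfl⟩ := exists_equiv_sum_of_mem k₀
  obtain ⟨P, Q, B', hP, hQ, hPQ, hB'⟩ := exists_pivot (B.submatrix τ σ) fun k j => hB _ _
  have h1 := h.reindex (Equiv.sumCongr (Equiv.refl _) σ) (Equiv.sumCongr (Equiv.refl _) τ)
  have h2 : (diagBlock p B).submatrix (Equiv.sumCongr (Equiv.refl _) τ)
      (Equiv.sumCongr (Equiv.refl _) σ) = diagBlock p (B.submatrix τ σ) := by
    ext (i | i) (j | j) <;> rfl
  rw [h2] at h1
  have hP' : IsUnit (Matrix.fromBlocks (1 : Matrix (Fin n) (Fin n) Γ(X, U)) 0 0 P) := by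
    rw [Matrix.isUnit_iff_isUnit_det, Matrix.det_fromBlocks_zero₂₁, Matrix.det_one, one_mul,
      ← Matrix.isUnit_iff_isUnit_det]
    exact hP
  have hQ' : IsUnit (Matrix.fromBlocks (1 : Matrix (Fin n) (Fin n) Γ(X, U)) 0 0 Q) := by
    rw [Matrix.isUnit_iff_isUnit_det, Matrix.det_fromBlocks_zero₂₁, Matrix.det_one, one_mul,
      ← Matrix.isUnit_iff_isUnit_det]
    exact hQ
  have h3 := (h1.mul hP' hQ' (B := diagBlock p
    (diagBlock (fun _ => B (τ (Sum.inl 0)) (σ (Sum.inl 0))) B')) (by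
    simp only [diagBlock, Matrix.fromBlocks_multiply, hPQ, Matrix.mul_zero, Matrix.zero_mul,
      Matrix.mul_one, Matrix.one_mul, add_zero, zero_add]
    rfl)).reindex
    (snocEquiv n a') (snocEquiv n b')
  rw [diagBlock_diagBlock_submatrix] at h3
  exact ⟨a', b', _, _, B', h3, hB'⟩

theorem hasDiagBlock_pullback (hE : IsLocallyFree E) (hF : IsLocallyFree F) {n : ℕ}
    (hφ : ∀ x : X, ∃ U : X.affineOpens, x ∈ U.1 ∧ HasDiagBlock φ n U.1)
    (g : Y ⟶ X) (hg : IsInvertible ((detIdeal φ n).comap g)) (y : Y) :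
    ∃ U : Y.affineOpens, y ∈ U.1 ∧ HasDiagBlock (pullbackMap g φ) (n + 1) U.1 := by
  obtain ⟨U, hxU, a, b, e, f, p, B, hA, -, hp, hB⟩ := hφ (g y)
  obtain ⟨W, hyW, q, hq, hqW⟩ := hg y
  obtain ⟨w, hwU, hyw⟩ := W.2.exists_basicOpen_le (V := g ⁻¹ᵁ U.1) ⟨y, hxU⟩ hyW
  have hq' := resO_mem_nonZeroDivisors W.2 (Y.basicOpen_le w) rfl hq
  have hV : IsAffineOpen (Y.basicOpen w) := W.2.basicOpen w
  -- Two descriptions of one ideal over `Y.basicOpen w`: generated by the pulled back minors, and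
  -- generated by the restriction of `q`.
  have h1 := ideal_comap g (detIdeal φ n) U ⟨_, hV⟩ hwU
  have h2 := ((detIdeal φ n).comap g).map_ideal (U := ⟨_, hV⟩) (V := W) (Y.basicOpen_le w)
  rw [hqW, Ideal.map_span, Set.image_singleton, h1, hA.detIdeal_eq hE hF, map_minorIdeal,
    diagBlock_map] at h2
  obtain ⟨hp', s, hs, hps, c, hc, hc'⟩ := exists_entry_factor
    (fun i k j => by simpa using map_dvd (pullO g hwU) (hB i k j)) hq' h2.symm
  have hA' := (hA.pullback g).res hwU
  -- The entries of `c` generate the unit ideal, so one of them is invertible near `y`; its position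
  -- is the pivot.
  have hcov := (hV.self_le_iSup_basicOpen_iff (s := Set.range fun kj : Fin b × Fin a =>
    c kj.1 kj.2)).mpr hc' hyw
  obtain ⟨⟨_, ⟨k₀, j₀⟩, rfl⟩, hyc⟩ := TopologicalSpace.Opens.mem_iSup.mp hcov
  have hle : Y.basicOpen (c k₀ j₀) ≤ Y.basicOpen w := Y.basicOpen_le _
  have hu : IsUnit (resO hle (c k₀ j₀)) := isUnit_resO hle rfl
  have hA'' := hA'.res hle
  have hD : ((diagBlock p B).map (g.app U.1).hom).map (resO hwU) =
      diagBlock (fun i => pullO g hwU (p i)) (B.map (pullO g hwU)) :=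
    diagBlock_map (pullO g hwU) p B
  rw [hD, diagBlock_map] at hA''
  have hent (k j) : ((B.map (pullO g hwU)).map (resO hle)) k j =
      resO hle s * resO hle (c k j) := by
    rw [← map_mul, ← hc]; rfl
  obtain ⟨a', b', e', f', B', hA₃, hB'⟩ := hA''.exists_snoc k₀ j₀ (fun k j => by
    rw [hent, hent, hu.mul_right_dvd]
    exact dvd_mul_right _ _)
  have hs' := resO_mem_nonZeroDivisors hV hle rfl hs
  have hdvd (i : Fin n) : resO hle (pullO g hwU (p i)) ∣
      ((B.map (pullO g hwU)).map (resO hle)) k₀ j₀ := by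
    rw [hent]
    exact (map_dvd _ (hps i)).mul_right _
  refine ⟨⟨_, hV.basicOpen (c k₀ j₀)⟩, hyc, a', b', e', f', _, B', hA₃, ?_, ?_, ?_⟩
  · intro i
    induction i using Fin.lastCases with
    | last =>
      rw [Fin.snoc_last, hent]
      exact mul_mem hs' hu.mem_nonZeroDivisors
    | cast i =>
      rw [Fin.snoc_castSucc]
      exact resO_mem_nonZeroDivisors hV hle rfl (hp' i)
  · intro i j hij
    induction j using Fin.lastCases with
    | last =>
      induction i using Fin.lastCases with
      | last => exact dvd_rfl
      | cast i =>
        rw [Fin.snoc_castSucc, Fin.snoc_last]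
        exact hdvd i
    | cast j =>
      induction i using Fin.lastCases with
      | last => exact absurd hij (not_le.mpr (Fin.castSucc_lt_last j))
      | cast i =>
        rw [Fin.snoc_castSucc, Fin.snoc_castSucc]
        exact map_dvd _ (map_dvd _ (hp i j hij))
  · intro i k j
    induction i using Fin.lastCases with
    | last =>
      rw [Fin.snoc_last]
      exact hB' k j
    | cast i =>
      rw [Fin.snoc_castSucc]
      exact (hdvd i).trans (hB' k j)

/-- With no blowups the diagonal part is empty and any local matrix is the block `B`. Each blowup
enters through the invertibility of the inverse image ideal. -/
theorem IsIteratedBlowup.hasDiagBlock (hE : IsLocallyFree E) (hF : IsLocallyFree F) {n : ℕ}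
    {g : Y ⟶ X} (hg : IsIteratedBlowup φ n g) (y : Y) :
    ∃ U : Y.affineOpens, y ∈ U.1 ∧ HasDiagBlock (pullbackMap g φ) n U.1 := by
  induction hg with
  | zero =>
    obtain ⟨W, hW, hyW, -, a, b, e, f, A, hA⟩ := exists_isMatrixOf (hE.pullback (𝟙 X))
      (hF.pullback (𝟙 X)) (pullbackMap (𝟙 X) φ) y ⊤ trivial
    have hA' := hA.reindex (Equiv.emptySum (Fin 0) (Fin a)) (Equiv.emptySum (Fin 0) (Fin b))
    have hD : A.submatrix (Equiv.emptySum (Fin 0) (Fin b)) (Equiv.emptySum (Fin 0) (Fin a)) =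
        diagBlock Fin.elim0 A := by
      ext (i | i) (j | j)
      · exact i.elim0
      · exact i.elim0
      · exact j.elim0
      · rfl
    rw [hD] at hA'
    exact ⟨⟨W, hW⟩, hyW, a, b, _, _, _, A, hA', fun i => i.elim0, fun i => i.elim0,
      fun i => i.elim0⟩
  | @succ n Y Y' g b _ hb ih =>
    obtain ⟨U, hyU, c, d, e, f, p, B, hA, h⟩ := hasDiagBlock_pullback (hE.pullback g)
      (hF.pullback g) ih b hb.invertible y
    exact ⟨U, hyU, c, d, _, _, p, B, hA.of_comp, h⟩

end Step

/-! ### Diagonal form, and vanishing of the last block -/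

section Forms

variable {X Y : Scheme.{u}} {E F : X.Modules} {φ : E ⟶ F}

lemma HasDiagBlock.hasDiagonalFormOver {r : ℕ} {U : X.Opens} {x : X} (hx : x ∈ U)
    (h : HasDiagBlock φ (r + 1) U) : HasDiagonalFormOver φ r U := by
  obtain ⟨a, b, e, f, p, B, hA, hnz, hp, hB⟩ := h
  have : Nonempty U := ⟨⟨x, hx⟩⟩
  exact ⟨a, b, e, f, p, B, hA, fun i => nonZeroDivisors.ne_zero (hnz i),
    fun i => hp _ _ (Fin.castSucc_lt_succ).le, hB _⟩

lemma IsIteratedBlowup.exists_eq_zero (hE : IsLocallyFree E) (hF : IsLocallyFree F) {m : ℕ}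
    (hm : detIdeal φ m = ⊥) {g : Y ⟶ X} (hg : IsIteratedBlowup φ m g) (y : Y) :
    ∃ U : Y.affineOpens, y ∈ U.1 ∧ ∃ (a b : ℕ)
      (e : Fin m ⊕ Fin a → Γ((Scheme.Modules.pullback g).obj E, U.1))
      (f : Fin m ⊕ Fin b → Γ((Scheme.Modules.pullback g).obj F, U.1)) (p : Fin m → Γ(Y, U.1)),
      IsMatrixOf (pullbackMap g φ) U.1 e f (diagBlock p 0) ∧
      (∀ i, p i ∈ nonZeroDivisors Γ(Y, U.1)) ∧ (∀ i j, i ≤ j → p i ∣ p j) := by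
  obtain ⟨U, hyU, a, b, e, f, p, B, hA, hnz, hp, hB⟩ := hg.hasDiagBlock hE hF y
  obtain ⟨V, hV, hyV, -, a', b', e', f', A', hA'⟩ := exists_isMatrixOf hE hF φ (g y) ⊤ trivial
  obtain ⟨w, hw, hyw⟩ := U.2.exists_basicOpen_le (V := g ⁻¹ᵁ V) ⟨y, hyV⟩ hyU
  have h1 := hA.res (Y.basicOpen_le w)
  rw [diagBlock_map] at h1
  have h2 := (hA'.pullback g).res hw
  have h3 : minorIdeal A' m = ⊥ := by
    rw [← hA'.detIdeal_eq hE hF (U := ⟨V, hV⟩), hm]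
    rfl
  have h4 : minorIdeal ((A'.map (g.app V).hom).map (resO hw)) m = ⊥ := by
    rw [← map_minorIdeal, ← map_minorIdeal, h3, Ideal.map_bot, Ideal.map_bot]
  rw [h1.minorIdeal_eq h2] at h4
  have hnz' (i) := resO_mem_nonZeroDivisors U.2 (Y.basicOpen_le w) rfl (hnz i)
  -- Each `(∏ p_i) * B k j` is, as an `(m+1)`-minor, zero, and `∏ p_i` is a nonzerodivisor.
  have hB0 : B.map (resO (Y.basicOpen_le w)) = 0 := by
    ext k j
    have h5 := prod_mul_mem_minorIdeal (fun i => resO (Y.basicOpen_le w) (p i))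
      (B.map (resO (Y.basicOpen_le w))) k j
    rw [h4, Ideal.mem_bot] at h5
    exact (mul_left_mem_nonZeroDivisors_eq_zero_iff (prod_mem fun i _ => hnz' i)).mp h5
  rw [hB0] at h1
  exact ⟨⟨_, U.2.basicOpen w⟩, hyw, a, b, _, _, _, h1, hnz',
    fun i j hij => map_dvd _ (hp i j hij)⟩

end Forms

/-! ### Grouping associated diagonal entries -/

section Grouping

variable {R : Type*} [CommRing R]

/-- A divisibility chain of nonzerodivisors can be grouped into classes of associated elements, so
that the representatives generate a strictly decreasing chain of ideals. -/
lemma exists_grouping {n : ℕ} (p : Fin n → R) (hp : ∀ i, p i ∈ nonZeroDivisors R)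
    (hdvd : ∀ i j, i ≤ j → p i ∣ p j) :
    ∃ (l : ℕ) (d : Fin l → ℕ) (q : Fin l → R) (σ : (Σ i, Fin (d i)) ≃ Fin n) (v : Fin n → R),
      (∀ k, IsUnit (v k)) ∧ (∀ s, p (σ s) = v (σ s) * q s.1) ∧
      (∀ i, q i ∈ nonZeroDivisors R) ∧
      (∀ i j, i < j → Ideal.span {q j} < Ideal.span {q i}) := by
  classical
  -- `T` picks the first index of each class of equal ideals; listing it increasingly orders the
  -- representatives by divisibility.
  let T : Finset (Fin n) :=
    Finset.univ.filter fun i => ∀ j < i, Ideal.span {p j} ≠ Ideal.span {p i}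
  let r : Fin T.card ↪o Fin n := T.orderEmbOfFin rfl
  have hc (k : Fin n) : ∃ i, Ideal.span {p (r i)} = Ideal.span {p k} := by
    obtain ⟨j, hj, hmin⟩ := WellFounded.has_min (wellFounded_lt (α := Fin n))
      {j | Ideal.span {p j} = Ideal.span {p k}} ⟨k, rfl⟩
    have hjT : j ∈ T := Finset.mem_filter.mpr ⟨Finset.mem_univ _, fun i hi h =>
      hmin i (h.trans hj) hi⟩
    obtain ⟨i, rfl⟩ : j ∈ Set.range r := by
      rw [Finset.range_orderEmbOfFin]
      exact hjT
    exact ⟨i, hj⟩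
  choose c hc using hc
  have hv (k : Fin n) : ∃ v, IsUnit v ∧ p k = v * p (r (c k)) := by
    obtain ⟨x, hx⟩ := Ideal.span_singleton_le_span_singleton.mp (hc k).ge
    obtain ⟨y, hy⟩ := Ideal.span_singleton_le_span_singleton.mp (hc k).le
    refine ⟨x, IsUnit.of_mul_eq_one y ?_, hx.trans (mul_comm _ _)⟩
    refine (mul_cancel_left_mem_nonZeroDivisors (hp (r (c k)))).mp ?_
    rw [← mul_assoc, ← hx, ← hy, mul_one]
  choose v hv hpv using hv
  let σ : (Σ i, Fin (Fintype.card {k // c k = i})) ≃ Fin n :=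
    (Equiv.sigmaCongrRight fun i => (Fintype.equivFin {k // c k = i}).symm).trans
      (Equiv.sigmaFiberEquiv c)
  have hσ (s) : c (σ s) = s.1 := ((Fintype.equivFin {k // c k = s.1}).symm s.2).2
  refine ⟨T.card, fun i => Fintype.card {k // c k = i}, fun i => p (r i), σ, v, hv, fun s => ?_,
    fun i => hp _, fun i j hij => ?_⟩
  · rw [hpv (σ s), hσ]
  · have hij' : r i < r j := r.lt_iff_lt.mpr hij
    refine lt_of_le_of_ne (Ideal.span_singleton_le_span_singleton.mpr (hdvd _ _ hij'.le)) ?_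
    have hj : r j ∈ T := T.orderEmbOfFin_mem rfl j
    exact ((Finset.mem_filter.mp hj).2 _ hij').symm

end Grouping

/-! ### Local diagonalizability -/

section Diagonalizable

variable {X : Scheme.{u}} {E F : X.Modules} {φ : E ⟶ F}

lemma IsMatrixOf.isDiagonalizableOver {U : X.Opens} {x : X} (hx : x ∈ U) {n a b : ℕ}
    {e : Fin n ⊕ Fin a → Γ(E, U)} {f : Fin n ⊕ Fin b → Γ(F, U)} {p : Fin n → Γ(X, U)}
    (hA : IsMatrixOf φ U e f (diagBlock p 0)) (hp : ∀ i, p i ∈ nonZeroDivisors Γ(X, U))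
    (hdvd : ∀ i j, i ≤ j → p i ∣ p j) : IsDiagonalizableOver φ U := by
  obtain ⟨l, d, q, σ, v, hv, hpq, hq, hlt⟩ := exists_grouping p hp hdvd
  have : Nonempty U := ⟨⟨x, hx⟩⟩
  have h1 := hA.reindex ((Equiv.sumCongr (Equiv.refl (Fin a)) σ).trans (Equiv.sumComm _ _))
    ((Equiv.sumCongr (Equiv.refl (Fin b)) σ).trans (Equiv.sumComm _ _))
  -- The units relating each `p` to its representative are absorbed into the target frame.
  have hQ : IsUnit (Matrix.diagonal (Sum.elim (fun _ : Fin b => 1) fun s => v (σ s)) :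
      Matrix (Fin b ⊕ Σ i, Fin (d i)) (Fin b ⊕ Σ i, Fin (d i)) Γ(X, U)) := by
    rw [Matrix.isUnit_diagonal, Pi.isUnit_iff]
    rintro (i | s)
    · exact isUnit_one
    · exact hv _
  have h2 := h1.mul isUnit_one hQ
    (B := Matrix.fromBlocks 0 0 0 (Matrix.diagonal fun s => q s.1)) (by
      refine (Matrix.mul_one _).trans ?_
      ext (i | i) (j | j)
      · simp
      · simp
      · simp
      · by_cases hij : i = j
        · subst hij
          simp [hpq]
        · simp [hij])
  obtain ⟨he, hf, hφ⟩ := h2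
  refine ⟨l, a, b, d, _, _, q, he, hf, fun j => ?_, fun i j => ?_,
    fun i => nonZeroDivisors.ne_zero (hq i), hlt⟩
  · rw [hφ]
    refine Finset.sum_eq_zero fun k _ => ?_
    rcases k with k | k
    · exact zero_smul _ _
    · exact zero_smul _ _
  · rw [hφ]
    refine (Finset.sum_eq_single (Sum.inr ⟨i, j⟩) (fun k _ hk => ?_) (by simp)).trans ?_
    · rcases k with k | k
      · exact zero_smul _ _
      · have : k ≠ ⟨i, j⟩ := fun h => hk (by rw [h])
        rw [Matrix.fromBlocks_apply₂₂, Matrix.diagonal_apply_ne _ this]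
        exact zero_smul _ _
    · rw [Matrix.fromBlocks_apply₂₂, Matrix.diagonal_apply_eq]

end Diagonalizable

/-! ### Kernels on integral schemes -/

section Kernel

variable {X : Scheme.{u}} {E F : X.Modules}

/-- Sections over an open subset. -/
noncomputable abbrev sectionsFunctor (U : X.Opens) : X.Modules ⥤ Ab.{u} :=
  Scheme.Modules.toPresheaf X ⋙
    (evaluation (TopologicalSpace.Opens X)ᵒᵖ Ab.{u}).obj (Opposite.op U)

instance (U : X.Opens) : (sectionsFunctor U).PreservesZeroMorphisms := ⟨fun _ _ => rfl⟩

/-- Left exactness lets sections of the kernel sheaf be computed as the kernel on sections. -/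
instance (U : X.Opens) : Limits.PreservesFiniteLimits (sectionsFunctor U) where
  preservesFiniteLimits J _ _ :=
    have : Limits.PreservesLimitsOfShape J
      ((evaluation (TopologicalSpace.Opens X)ᵒᵖ Ab.{u}).obj (Opposite.op U)) := inferInstance
    Limits.comp_preservesLimitsOfShape (Scheme.Modules.toPresheaf X) _

lemma appM_kernel_ι_injective (ψ : E ⟶ F) (U : X.Opens) :
    Function.Injective (appM (Limits.kernel.ι ψ) U) :=
  (AddCommGrpCat.mono_iff_injective _).mp
    (inferInstanceAs (Mono ((sectionsFunctor U).map (Limits.kernel.ι ψ))))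

lemma exists_appM_kernel_ι (ψ : E ⟶ F) (U : X.Opens) {s : Γ(E, U)} (hs : appM ψ U s = 0) :
    ∃ t, appM (Limits.kernel.ι ψ) U t = s := by
  have h := (ShortComplex.exact_kernel ψ).map_of_mono_of_preservesKernel (sectionsFunctor U)
    inferInstance inferInstance
  exact (ShortComplex.ab_exact_iff _).mp h s hs

/-- On an integral scheme, the kernel of a locally diagonal map is locally free. -/
theorem isLocallyFree_kernel [IsIntegral X] (ψ : E ⟶ F)
    (h : ∀ x : X, ∃ U : X.Opens, x ∈ U ∧ ∃ (n a b : ℕ) (e : Fin n ⊕ Fin a → Γ(E, U))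
      (f : Fin n ⊕ Fin b → Γ(F, U)) (p : Fin n → Γ(X, U)),
      IsMatrixOf ψ U e f (diagBlock p 0)) :
    IsLocallyFree (Limits.kernel ψ) := by
  classical
  intro x
  obtain ⟨U, hxU, n, a, b, e, f, p, hA⟩ := h x
  have he : IsFrame E U e := hA.1
  -- The diagonal padded by zeros; the `e i` with `P i = 0` will lift to a frame of the kernel.
  let P : Fin n ⊕ Fin a → Γ(X, U) := Sum.elim p 0
  have hmul {V : X.Opens} (hV : V ≤ U) (c : Fin n ⊕ Fin a → Γ(X, V))
      (hc : appM ψ V (∑ i, c i • resM E hV (e i)) = 0) (i : Fin n ⊕ Fin a) :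
      resO hV (P i) * c i = 0 := by
    have h1 := hA.res hV
    rw [diagBlock_map] at h1
    rw [h1.appM_sum] at hc
    have h2 := h1.2.1.bijective.1 (hc.trans (by simp : (0 : Γ(F, V)) =
      ∑ i, (0 : Fin n ⊕ Fin b → Γ(X, V)) i • resM F hV (f i)))
    rcases i with i | i
    · have h3 := congrFun h2 (Sum.inl i)
      have h4 : resO hV (p i) * c (Sum.inl i) = 0 := by
        simpa [Matrix.mulVec, dotProduct, Matrix.diagonal_apply] using h3
      exact h4
    · simp [P]
  have hker (i : {i // P i = 0}) : ∃ k, appM (Limits.kernel.ι ψ) U k = e i.1 := by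
    refine exists_appM_kernel_ι ψ U ?_
    have h1 : appM ψ U (e i.1) = _ := hA.2.2 i.1
    rw [h1]
    refine Finset.sum_eq_zero fun k _ => ?_
    have h2 : diagBlock p (0 : Matrix (Fin b) (Fin a) Γ(X, U)) k i.1 = 0 := by
      obtain ⟨i | i, hi⟩ := i
      · rcases k with k | k
        · by_cases hki : k = i
          · subst hki
            simpa using! hi
          · simp [hki]
        · simp
      · rcases k with k | k <;> simp
    rw [h2]
    exact zero_smul _ _
  choose k hk using hker
  have hframe : IsFrame (Limits.kernel ψ) U k := by
    rw [isFrame_iff]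
    intro V hV
    have hsum (c : {i // P i = 0} → Γ(X, V)) :
        appM (Limits.kernel.ι ψ) V (∑ i, c i • resM _ hV (k i)) =
          ∑ i, (fun i => if hi : P i = 0 then c ⟨i, hi⟩ else 0) i • resM E hV (e i) := by
      rw [map_sum]
      simp only [map_smul, appM_resM, hk]
      rw [← Finset.sum_subset (Finset.subset_univ (Finset.univ.filter fun i => P i = 0))]
      · rw [Finset.sum_subtype (p := fun i => P i = 0) _ (by simp)]
        refine Finset.sum_congr rfl fun i _ => ?_
        simp [i.2]
      · intro i _ hi
        have hi' : P i ≠ 0 := by simpa using hi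
        simp [hi']
    constructor
    · intro c c' hcc
      have h1 := congrArg (appM (Limits.kernel.ι ψ) V) hcc
      simp only [hsum] at h1
      have h2 := (isFrame_iff.mp he V hV).1 h1
      funext i
      simpa [i.2] using congrFun h2 i.1
    · intro s
      obtain ⟨c, hc⟩ := (isFrame_iff.mp he V hV).2 (appM (Limits.kernel.ι ψ) V s)
      have hc' : ∑ i, c i • resM E hV (e i) = appM (Limits.kernel.ι ψ) V s := hc
      have h0 : appM ψ V (∑ i, c i • resM E hV (e i)) = 0 := by
        rw [hc', ← appM_comp, Limits.kernel.condition, appM_zero]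
      have hzero (i) (hi : P i ≠ 0) : c i = 0 := by
        have h1 := hmul hV c h0 i
        -- Over the empty set the ring is zero. Otherwise it is a domain into which `Γ(X, U)`
        -- injects, so `P i` stays nonzero and can be cancelled.
        rcases isEmpty_or_nonempty V with hVe | hVn
        · have : V = ⊥ := by
            ext y
            simpa using fun hy => hVe.false ⟨y, hy⟩
          subst this
          exact Subsingleton.elim _ _
        · refine (mul_eq_zero.mp h1).resolve_left fun h2 => hi ?_
          exact (map_injective_of_isIntegral X (homOfLE hV)) (h2.trans (map_zero _).symm)
      refine ⟨fun i => c i.1, appM_kernel_ι_injective ψ V ?_⟩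
      refine (hsum _).trans (Eq.trans ?_ hc')
      refine Finset.sum_congr rfl fun i _ => ?_
      by_cases hi : P i = 0
      · simp [hi]
      · simp [hi, hzero i hi]
  exact ⟨U, hxU, _, _, hframe.reindex (Fintype.equivFin _).symm⟩

lemma isIntegral_of_range_mem_irreducibleComponents {Y : Scheme.{u}} (i : Y ⟶ X)
    [IsClosedImmersion i] [IsReduced Y] (h : Set.range i ∈ irreducibleComponents X) :
    IsIntegral Y := by
  have h1 : IrreducibleSpace (Set.range i) := Subtype.irreducibleSpace h.1
  let t := i.isClosedEmbedding.isEmbedding.toHomeomorph.symm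
  have h2 := (IrreducibleSpace.isIrreducible_univ (Set.range i)).image t t.continuous.continuousOn
  rw [Set.image_univ, t.surjective.range_eq] at h2
  have : IrreducibleSpace Y := (irreducibleSpace_def Y).mpr h2
  exact isIntegral_of_irreducibleSpace_of_isReduced Y

end Kernel

end DetBlowup

theorem mainTheorem2 {X : Scheme.{u}} {E F : X.Modules} (φ : E ⟶ F)
    (hE : DetBlowup.IsLocallyFree E) (hF : DetBlowup.IsLocallyFree F)
    (m : ℕ) (hm : IsLeast {k : ℕ | DetBlowup.detIdeal φ k = ⊥} m) :
    (∀ r : ℕ, r < m → ∀ (Xr : Scheme.{u}) (g : Xr ⟶ X),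
      DetBlowup.IsIteratedBlowup φ (r + 1) g →
      ∀ x : Xr, ∃ U : Xr.Opens, x ∈ U ∧
        DetBlowup.HasDiagonalFormOver (DetBlowup.pullbackMap g φ) r U) ∧
    (∀ (Xt : Scheme.{u}) (b : Xt ⟶ X), DetBlowup.IsIteratedBlowup φ m b →
      DetBlowup.IsLocallyDiagonalizable (DetBlowup.pullbackMap b φ) ∧
      ∀ (X' : Scheme.{u}) (i : X' ⟶ Xt) [IsClosedImmersion i] [IsReduced X'],
        Set.range i ∈ irreducibleComponents Xt →
        DetBlowup.IsLocallyFree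
          (Limits.kernel (DetBlowup.pullbackMap i (DetBlowup.pullbackMap b φ)))) := by
  refine ⟨fun r _ Xr g hg x => ?_, fun Xt b hb => ⟨fun x => ?_, fun X' i _ _ hi => ?_⟩⟩
  · obtain ⟨U, hxU, hU⟩ := hg.hasDiagBlock hE hF x
    exact ⟨U, hxU, hU.hasDiagonalFormOver hxU⟩
  · obtain ⟨U, hxU, a, c, e, f, p, hA, hp, hdvd⟩ := hb.exists_eq_zero hE hF hm.1 x
    exact ⟨U, hxU, hA.isDiagonalizableOver hxU hp hdvd⟩
  · have := DetBlowup.isIntegral_of_range_mem_irreducibleComponents i hi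
    refine DetBlowup.isLocallyFree_kernel _ fun x => ?_
    obtain ⟨U, hxU, a, c, e, f, p, hA, -, -⟩ := hb.exists_eq_zero hE hF hm.1 (i x)
    -- The diagonal shape survives restriction to the component, and nothing more about the entries
    -- is needed for the kernel.
    have hA' := hA.pullback i
    rw [DetBlowup.diagBlock_map, Matrix.map_zero _ (map_zero _)] at hA'
    exact ⟨i ⁻¹ᵁ U.1, hxU, _, _, _, _, _, _, hA'⟩
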